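/- Let $k\ge 1$ be an integer and let $a\in C^\infty(\mathbf R)$ be real valued. In $\mathbf R^3=\{(x,y,t)\}$ put $X=\partial_x$, $Y=\partial_y+x^k\partial_t$ and $$L=-X^2-Y^2+i\,a(x)[X,Y].$$ Say that $L$ is locally solvable at $0$ if there is an open neighbourhood $V$ of $0$ such that for every $f\in C_0^\infty(V)$ there is a distribution $u\in\mathcal D'(V)$ with $Lu=f$ in $V$. Say that $L$ is locally solvable in $L^2$ at $0$ if for every $f\in L^2(\mathbf R^3)$ there are an open neighbourhood $V$ of $0$ and a locally square integrable function $u$ on $V$ such that $Lu=f$ in $V$ in the sense of distributions. (1) Suppose that either $k=1$ and $a(0)\in\{\pm1,\pm3,\pm5,\dots\}$, or $k>1$ is odd and $a(0)\in\{\pm1\}$. If $a'(0)=a''(0)=0$, then $L$ is not locally solvable in $L^2$ at $0$. (2) Some of the locally solvable operators of this family lose derivatives: there exist $k\ge1$ and a real valued $a\in C^\infty(\mathbf R)$ such that $L$ is locally solvable at $0$ but is not locally solvable in $L^2$ at $0$. -/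

import Mathlib

open MeasureTheory TopologicalSpace
open scoped ContDiff Distributions

noncomputable section

namespace DoubleChar

/-- Points `(x, y, t)` of `ℝ³`. -/
abbrev R3 : Type := ℝ × ℝ × ℝ

/-- The vector field `X = ∂_x`. -/
def X (u : R3 → ℂ) : R3 → ℂ := fun p => fderiv ℝ u p (1, 0, 0)

/-- The vector field `Y = ∂_y + x ^ k ∂_t`. -/
def Y (k : ℕ) (u : R3 → ℂ) : R3 → ℂ := fun p => fderiv ℝ u p (0, 1, p.1 ^ k)

/-- The commutator `[X, Y] = X Y - Y X`. -/
def XY (k : ℕ) (u : R3 → ℂ) : R3 → ℂ := fun p => X (Y k u) p - Y k (X u) p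

/-- The operator `L = -X² - Y² + i a(x) [X, Y]`, acting on smooth functions. -/
def L (k : ℕ) (a : ℝ → ℝ) (u : R3 → ℂ) : R3 → ℂ := fun p =>
  -X (X u) p - Y k (Y k u) p + Complex.I * (a p.1 : ℂ) * XY k u p

/-- The transpose of `L` with respect to the bilinear pairing `∫ u v`; it is obtained from `L`
by replacing `a` by `-a`, see `integral_L_mul`. -/
def Lt (k : ℕ) (a : ℝ → ℝ) (u : R3 → ℂ) : R3 → ℂ := L k (fun x => -a x) u

section Regularity

variable {u v : R3 → ℂ} {k : ℕ} {a : ℝ → ℝ}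

lemma contDiff_X (hu : ContDiff ℝ ∞ u) : ContDiff ℝ ∞ (X u) := by
  have h : ContDiff ℝ ∞ (fderiv ℝ u) := hu.fderiv_right (by simp)
  exact h.clm_apply contDiff_const

lemma contDiff_Y (hu : ContDiff ℝ ∞ u) : ContDiff ℝ ∞ (Y k u) := by
  have h : ContDiff ℝ ∞ (fderiv ℝ u) := hu.fderiv_right (by simp)
  exact h.clm_apply (contDiff_const.prodMk (contDiff_const.prodMk (contDiff_fst.pow k)))

lemma contDiff_coeff (ha : ContDiff ℝ ∞ a) :
    ContDiff ℝ ∞ (fun p : R3 => Complex.I * (a p.1 : ℂ)) :=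
  contDiff_const.mul (Complex.ofRealCLM.contDiff.comp (ha.comp contDiff_fst))

lemma contDiff_L (ha : ContDiff ℝ ∞ a) (hu : ContDiff ℝ ∞ u) : ContDiff ℝ ∞ (L k a u) :=
  ((contDiff_X (contDiff_X hu)).neg.sub (contDiff_Y (contDiff_Y hu))).add
    ((contDiff_coeff ha).mul
      ((contDiff_X (contDiff_Y hu)).sub (contDiff_Y (contDiff_X hu))))

lemma tsupport_X_subset : tsupport (X u) ⊆ tsupport u :=
  (closure_mono fun p hp => by
    contrapose! hp
    simp [X, Function.notMem_support.1 hp]).trans (tsupport_fderiv_subset ℝ (f := u))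

lemma tsupport_Y_subset : tsupport (Y k u) ⊆ tsupport u :=
  (closure_mono fun p hp => by
    contrapose! hp
    simp [Y, Function.notMem_support.1 hp]).trans (tsupport_fderiv_subset ℝ (f := u))

lemma tsupport_L_subset : tsupport (L k a u) ⊆ tsupport u := by
  refine closure_minimal (fun p hp => ?_) (isClosed_tsupport u)
  by_contra h
  have hX : ∀ {w : R3 → ℂ}, p ∉ tsupport w → X w p = 0 := fun hw =>
    image_eq_zero_of_notMem_tsupport fun h' => hw (tsupport_X_subset h')
  have hY : ∀ {w : R3 → ℂ}, p ∉ tsupport w → Y k w p = 0 := fun hw =>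
    image_eq_zero_of_notMem_tsupport fun h' => hw (tsupport_Y_subset h')
  have h1 : p ∉ tsupport (X u) := fun h' => h (tsupport_X_subset h')
  have h2 : p ∉ tsupport (Y k u) := fun h' => h (tsupport_Y_subset h')
  exact hp (by simp [L, XY, hX h1, hX h2, hY h1, hY h2])

end Regularity

/-- The transpose of `L` as a map from `C₀^∞(V)` to itself. -/
def LtTest (k : ℕ) (a : ℝ → ℝ) (ha : ContDiff ℝ ∞ a) {V : Opens R3} (ψ : 𝓓(V, ℂ)) : 𝓓(V, ℂ) where
  toFun := Lt k a ψ
  contDiff' := contDiff_L ha.neg ψ.contDiff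
  hasCompactSupport' :=
    ψ.hasCompactSupport.of_isClosed_subset (isClosed_tsupport _) tsupport_L_subset
  tsupport_subset' := tsupport_L_subset.trans ψ.tsupport_subset

/-- Local solvability at the origin: there is an open neighbourhood `V` of `0` such that for every
`f ∈ C₀^∞(V)` there is a distribution `u ∈ 𝓓'(V)` (a continuous linear form on `C₀^∞(V)`) with
`L u = f` in `V`. -/
def LocallySolvable (k : ℕ) (a : ℝ → ℝ) (ha : ContDiff ℝ ∞ a) : Prop :=
  ∃ V : Opens R3, (0 : R3) ∈ V ∧ ∀ f : 𝓓(V, ℂ), ∃ u : 𝓓(V, ℂ) →L[ℂ] ℂ,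
    ∀ ψ : 𝓓(V, ℂ), u (LtTest k a ha ψ) = ∫ p, f p * ψ p

/-- `u` is locally square integrable on the open set `V`. -/
def LocL2 (V : Opens R3) (u : R3 → ℂ) : Prop :=
  ∀ K : Set R3, IsCompact K → K ⊆ V → MemLp u 2 (volume.restrict K)

/-- Local solvability in `L²` at the origin: for every `f ∈ L²` there is a locally square
integrable `u` with `L u = f`, in the sense of distributions, in a neighbourhood of `0`
(which may depend on `f`). -/
def LocallySolvableL2 (k : ℕ) (a : ℝ → ℝ) : Prop :=
  ∀ f : R3 → ℂ, MemLp f 2 volume →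
    ∃ V : Opens R3, (0 : R3) ∈ V ∧ ∃ u : R3 → ℂ, LocL2 V u ∧
      ∀ ψ : 𝓓(V, ℂ), ∫ p, u p * Lt k a ψ p = ∫ p, f p * ψ p

section Transpose

variable {u v : R3 → ℂ} {k : ℕ} {a : ℝ → ℝ}

lemma X_mul (hu : Differentiable ℝ u) (hv : Differentiable ℝ v) :
    X (fun p => u p * v p) = fun p => u p * X v p + X u p * v p := by
  funext p
  simp only [X, fderiv_fun_mul (hu p) (hv p)]
  simp [mul_comm]

lemma Y_mul (hu : Differentiable ℝ u) (hv : Differentiable ℝ v) :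
    Y k (fun p => u p * v p) = fun p => u p * Y k v p + Y k u p * v p := by
  funext p
  simp only [Y, fderiv_fun_mul (hu p) (hv p)]
  simp [mul_comm]

lemma integrable_of_supp (hu : Continuous u) (hc : HasCompactSupport u) : Integrable u :=
  hu.integrable_of_hasCompactSupport hc

lemma hasCompactSupport_X (hc : HasCompactSupport u) : HasCompactSupport (X u) :=
  hc.of_isClosed_subset (isClosed_tsupport _) tsupport_X_subset

lemma hasCompactSupport_Y (hc : HasCompactSupport u) : HasCompactSupport (Y k u) :=
  hc.of_isClosed_subset (isClosed_tsupport _) tsupport_Y_subset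

lemma integral_fderiv_const_mul (j : ℕ) (hu : ContDiff ℝ ∞ u) (hc : HasCompactSupport u) (w : R3)
    (hw : j = 0 ∨ w.1 = 0) : ∫ p : R3, ((p.1 ^ j : ℝ) : ℂ) * fderiv ℝ u p w = 0 := by
  have hg : ContDiff ℝ ∞ (fun p : R3 => ((p.1 ^ j : ℝ) : ℂ)) :=
    Complex.ofRealCLM.contDiff.comp (contDiff_fst.pow j)
  have hg0 : ∀ p : R3, fderiv ℝ (fun p : R3 => ((p.1 ^ j : ℝ) : ℂ)) p w = 0 := by
    intro p
    rcases hw with rfl | hw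
    · simp
    · have h1 : HasFDerivAt (fun p : R3 => p.1 ^ j)
          ((j * p.1 ^ (j - 1)) • ContinuousLinearMap.fst ℝ ℝ (ℝ × ℝ)) p := by
        have := (hasDerivAt_pow j p.1).comp_hasFDerivAt p
          (ContinuousLinearMap.fst ℝ ℝ (ℝ × ℝ)).hasFDerivAt
        exact this
      have h2 := (Complex.ofRealCLM.hasFDerivAt (x := p.1 ^ j)).comp p h1
      have h3 : HasFDerivAt (fun p : R3 => ((p.1 ^ j : ℝ) : ℂ)) _ p := h2
      rw [h3.fderiv]
      simp [hw]
  have hfc : Continuous (fun p => fderiv ℝ u p w) :=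
    (hu.continuous_fderiv (by simp)).clm_apply continuous_const
  have hfs : HasCompactSupport (fun p => fderiv ℝ u p w) := hc.fderiv_apply ℝ w
  have : (volume : Measure (ℝ × ℝ)).IsAddHaarMeasure :=
    inferInstanceAs ((volume : Measure ℝ).prod (volume : Measure ℝ)).IsAddHaarMeasure
  have : (volume : Measure R3).IsAddHaarMeasure :=
    inferInstanceAs ((volume : Measure ℝ).prod (volume : Measure (ℝ × ℝ))).IsAddHaarMeasure
  rw [integral_mul_fderiv_eq_neg_fderiv_mul_of_integrable]
  · simp only [hg0, zero_mul, integral_zero, neg_zero]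
  · simp only [hg0, zero_mul]
    exact integrable_zero _ _ _
  · exact integrable_of_supp (hg.continuous.mul hfc) hfs.mul_left
  · exact integrable_of_supp (hg.continuous.mul hu.continuous) hc.mul_left
  · exact fun p _ => (hg.differentiable (by simp)) p
  · exact fun p _ => (hu.differentiable (by simp)) p

lemma integral_X (hu : ContDiff ℝ ∞ u) (hc : HasCompactSupport u) : ∫ p, X u p = 0 := by
  simpa [X] using integral_fderiv_const_mul 0 hu hc (1, 0, 0) (Or.inl rfl)

lemma integral_Y (hu : ContDiff ℝ ∞ u) (hc : HasCompactSupport u) : ∫ p, Y k u p = 0 := by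
  have h1 := integral_fderiv_const_mul 0 hu hc (0, 1, 0) (Or.inl rfl)
  have h2 := integral_fderiv_const_mul k hu hc (0, 0, 1) (Or.inr rfl)
  have hfc : ∀ w, Continuous (fun p => fderiv ℝ u p w) := fun w =>
    (hu.continuous_fderiv (by simp)).clm_apply continuous_const
  have hfs : ∀ w, HasCompactSupport (fun p => fderiv ℝ u p w) := fun w => hc.fderiv_apply ℝ w
  have hg : Continuous (fun p : R3 => ((p.1 ^ k : ℝ) : ℂ)) := by fun_prop
  have hY : ∀ p, Y k u p = ((p.1 ^ 0 : ℝ) : ℂ) * fderiv ℝ u p (0, 1, 0) +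
      ((p.1 ^ k : ℝ) : ℂ) * fderiv ℝ u p (0, 0, 1) := by
    intro p
    have : ((0, 1, p.1 ^ k) : R3) = (0, 1, 0) + (p.1 ^ k) • (0, 0, 1) := by simp
    rw [Y, this, map_add, map_smul]
    simp
  simp_rw [hY]
  rw [integral_add, h1, h2, add_zero]
  · simpa using integrable_of_supp (hfc _) (hfs _)
  · exact integrable_of_supp (hg.mul (hfc _)) (hfs _).mul_left

lemma integral_X_mul (hu : ContDiff ℝ ∞ u) (hv : ContDiff ℝ ∞ v) (hc : HasCompactSupport v) :
    ∫ p, X u p * v p = -∫ p, u p * X v p := by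
  have h := integral_X (hu.mul hv) hc.mul_left
  rw [X_mul (hu.differentiable (by simp)) (hv.differentiable (by simp)), integral_add] at h
  · linear_combination h
  · exact integrable_of_supp (hu.continuous.mul (contDiff_X hv).continuous)
      (hasCompactSupport_X hc).mul_left
  · exact integrable_of_supp ((contDiff_X hu).continuous.mul hv.continuous) hc.mul_left

lemma integral_Y_mul (hu : ContDiff ℝ ∞ u) (hv : ContDiff ℝ ∞ v) (hc : HasCompactSupport v) :
    ∫ p, Y k u p * v p = -∫ p, u p * Y k v p := by
  have h := integral_Y (k := k) (hu.mul hv) hc.mul_left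
  rw [Y_mul (hu.differentiable (by simp)) (hv.differentiable (by simp)), integral_add] at h
  · linear_combination h
  · exact integrable_of_supp (hu.continuous.mul (contDiff_Y hv).continuous)
      (hasCompactSupport_Y hc).mul_left
  · exact integrable_of_supp ((contDiff_Y hu).continuous.mul hv.continuous) hc.mul_left

/-- Multiplication by a function of `x` alone commutes with `[X, Y]`. -/
lemma XY_coeff_mul (ha : ContDiff ℝ ∞ a) (hv : ContDiff ℝ ∞ v) :
    XY k (fun p => Complex.I * (a p.1 : ℂ) * v p) =
      fun p => Complex.I * (a p.1 : ℂ) * XY k v p := by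
  have hA := contDiff_coeff ha
  have hd : ∀ {w : R3 → ℂ}, ContDiff ℝ ∞ w → Differentiable ℝ w := fun hw =>
    hw.differentiable (by simp)
  have hline : ∀ p w : R3, w.1 = 0 →
      fderiv ℝ (fun p : R3 => Complex.I * (a p.1 : ℂ)) p w = 0 := by
    intro p w hw
    have h1 : HasFDerivAt (fun q : R3 => Complex.I * (a q.1 : ℂ))
        ((fderiv ℝ (fun x : ℝ => Complex.I * (a x : ℂ)) p.1).comp
          (ContinuousLinearMap.fst ℝ ℝ (ℝ × ℝ))) p := by
      have hb : DifferentiableAt ℝ (fun x : ℝ => Complex.I * (a x : ℂ)) p.1 :=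
        ((contDiff_const.mul (Complex.ofRealCLM.contDiff.comp ha)).differentiable
          (n := ∞) (by simp)) p.1
      exact hb.hasFDerivAt.comp p (ContinuousLinearMap.fst ℝ ℝ (ℝ × ℝ)).hasFDerivAt
    rw [h1.fderiv]
    simp [hw]
  have hYA : ∀ p, Y k (fun p : R3 => Complex.I * (a p.1 : ℂ)) p = 0 := fun p => hline p _ rfl
  have hYXA : ∀ p, Y k (X fun p : R3 => Complex.I * (a p.1 : ℂ)) p = 0 := by
    intro p
    have h0 : (X fun p : R3 => Complex.I * (a p.1 : ℂ)) =
        fun p => Complex.I * ((deriv a p.1 : ℝ) : ℂ) := by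
      funext q
      have h1 : HasFDerivAt (fun q : R3 => Complex.I * (a q.1 : ℂ))
          ((ContinuousLinearMap.toSpanSingleton ℝ (Complex.I * ((deriv a q.1 : ℝ) : ℂ))).comp
            (ContinuousLinearMap.fst ℝ ℝ (ℝ × ℝ))) q := by
        have hb : HasDerivAt (fun x : ℝ => Complex.I * (a x : ℂ))
            (Complex.I * ((deriv a q.1 : ℝ) : ℂ)) q.1 :=
          (((ha.differentiable (by simp)) q.1).hasDerivAt.ofReal_comp).const_mul _
        exact hb.hasFDerivAt.comp q (ContinuousLinearMap.fst ℝ ℝ (ℝ × ℝ)).hasFDerivAt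
      rw [X, h1.fderiv]
      simp
    have ha' : ContDiff ℝ ∞ (deriv a) := ContDiff.deriv' (n := ∞) (by simpa using ha)
    rw [h0]
    have hb : DifferentiableAt ℝ (fun x : ℝ => Complex.I * ((deriv a x : ℝ) : ℂ)) p.1 :=
      ((contDiff_const.mul (Complex.ofRealCLM.contDiff.comp ha')).differentiable
        (n := ∞) (by simp)) p.1
    have h1 : HasFDerivAt (fun q : R3 => Complex.I * ((deriv a q.1 : ℝ) : ℂ))
        ((fderiv ℝ (fun x : ℝ => Complex.I * ((deriv a x : ℝ) : ℂ)) p.1).comp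
          (ContinuousLinearMap.fst ℝ ℝ (ℝ × ℝ))) p :=
      hb.hasFDerivAt.comp p (ContinuousLinearMap.fst ℝ ℝ (ℝ × ℝ)).hasFDerivAt
    rw [Y, h1.fderiv]
    simp
  set A : R3 → ℂ := fun p => Complex.I * (a p.1 : ℂ) with hAdef
  have e1 : Y k (fun p => A p * v p) = fun p => A p * Y k v p := by
    rw [Y_mul (hd hA) (hd hv)]
    funext p
    simp [hYA p]
  have e2 : Y k (fun p => A p * X v p + X A p * v p) =
      fun p => A p * Y k (X v) p + X A p * Y k v p := by
    have h1 := Y_mul (k := k) (hd hA) (hd (contDiff_X hv))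
    have h2 := Y_mul (k := k) (hd (contDiff_X hA)) (hd hv)
    funext p
    have h3 : Y k (fun p => A p * X v p + X A p * v p) p =
        Y k (fun p => A p * X v p) p + Y k (fun p => X A p * v p) p := by
      simp only [Y]
      rw [fderiv_fun_add ((hd (hA.mul (contDiff_X hv))) p) ((hd ((contDiff_X hA).mul hv)) p)]
      simp
    rw [h3, h1, h2]
    simp [hYA p, hYXA p]
  funext p
  change X (Y k fun p => A p * v p) p - Y k (X fun p => A p * v p) p = A p * XY k v p
  rw [e1, X_mul (hd hA) (hd (contDiff_Y hv)), X_mul (hd hA) (hd hv), e2, XY]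
  ring

/-- `Lt` is the transpose of `L`. -/
theorem integral_L_mul (ha : ContDiff ℝ ∞ a) (hu : ContDiff ℝ ∞ u) (hv : ContDiff ℝ ∞ v)
    (hc : HasCompactSupport v) : ∫ p, L k a u p * v p = ∫ p, u p * Lt k a v p := by
  have hA := contDiff_coeff ha
  set w : R3 → ℂ := fun p => Complex.I * (a p.1 : ℂ) * v p with hw
  have hwd : ContDiff ℝ ∞ w := hA.mul hv
  have hwc : HasCompactSupport w := hc.mul_left
  have hint : ∀ {f g : R3 → ℂ}, ContDiff ℝ ∞ f → ContDiff ℝ ∞ g → HasCompactSupport g →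
      Integrable (fun p => f p * g p) := fun hf hg h =>
    integrable_of_supp (hf.continuous.mul hg.continuous) h.mul_left
  have l1 : ∀ p, L k a u p * v p = -(X (X u) p * v p) - Y k (Y k u) p * v p
      + (X (Y k u) p * w p - Y k (X u) p * w p) := by
    intro p
    simp only [L, XY, hw]
    ring
  have l2 : ∀ p, u p * Lt k a v p = -(u p * X (X v) p) - u p * Y k (Y k v) p
      + (u p * Y k (X w) p - u p * X (Y k w) p) := by
    intro p
    have h := congrFun (XY_coeff_mul (k := k) ha hv) p
    simp only [XY] at h
    simp only [Lt, L, XY]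
    push_cast
    linear_combination (u p) * h
  have split : ∀ {f₁ f₂ f₃ f₄ : R3 → ℂ}, Integrable f₁ → Integrable f₂ → Integrable f₃ →
      Integrable f₄ → ∫ p, (-f₁ p - f₂ p + (f₃ p - f₄ p)) =
        -(∫ p, f₁ p) - (∫ p, f₂ p) + ((∫ p, f₃ p) - ∫ p, f₄ p) := by
    intro f₁ f₂ f₃ f₄ h₁ h₂ h₃ h₄
    change ∫ p, ((-f₁ - f₂) + (f₃ - f₄)) p = _
    rw [integral_add' (h₁.neg.sub h₂) (h₃.sub h₄), integral_sub' h₁.neg h₂,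
      integral_sub' h₃ h₄, integral_neg']
  have cX : ∀ {f : R3 → ℂ}, ContDiff ℝ ∞ f → ContDiff ℝ ∞ (X f) := contDiff_X
  have cY : ∀ {f : R3 → ℂ}, ContDiff ℝ ∞ f → ContDiff ℝ ∞ (Y k f) := contDiff_Y
  have sX : ∀ {f : R3 → ℂ}, HasCompactSupport f → HasCompactSupport (X f) := hasCompactSupport_X
  have sY : ∀ {f : R3 → ℂ}, HasCompactSupport f → HasCompactSupport (Y k f) := hasCompactSupport_Y
  simp_rw [l1, l2]
  rw [split (hint (cX (cX hu)) hv hc) (hint (cY (cY hu)) hv hc) (hint (cX (cY hu)) hwd hwc)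
      (hint (cY (cX hu)) hwd hwc),
    split (hint hu (cX (cX hv)) (sX (sX hc))) (hint hu (cY (cY hv)) (sY (sY hc)))
      (hint hu (cY (cX hwd)) (sY (sX hwc))) (hint hu (cX (cY hwd)) (sX (sY hwc))),
    integral_X_mul (cX hu) hv hc, integral_X_mul hu (cX hv) (sX hc),
    integral_Y_mul (cY hu) hv hc, integral_Y_mul hu (cY hv) (sY hc),
    integral_X_mul (cY hu) hwd hwc, integral_Y_mul hu (cX hwd) (sX hwc),
    integral_Y_mul (cX hu) hwd hwc, integral_X_mul hu (cY hwd) (sY hwc)]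
  ring

end Transpose

end DoubleChar

end

/-!
Solvability in `L²` would give, by the uniform boundedness principle, an estimate of `‖ψ‖` by
`‖Lt ψ‖` for test functions `ψ` near the origin. It fails as soon as `Lt` has approximate null
solutions concentrating at the origin. The identity
`L = -(X - iY)(X + iY) + i (1 + a) [X, Y]` shows that, for constant `a = 2m + 1` and `k = 1` or
`m = 0`, the function `(x - iy)^m ζ^(-N)` is an exact null solution of `Lt`, where `ζ` is a solution
of `(X + iY) ζ = 0` with positive real part. Dilated and cut off, it remains an approximate null
solution when `a` takes the value `2m + 1` at the origin only, because `a` is flat to third order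
there. The values `-(2m + 1)` follow by complex conjugation.

For `k = 1` and `a = 1 - x⁴`, let `n`, `nX`, `nY` be the squared norms of `u`, `Xu`, `Yu` after
Fourier transform in `t` at frequency `τ`, let `n₂` be that of `x²u` and put `θ = 2πτ`. The energy
`⟨Lt u, u⟩` is then `nX + nY + θ (n - n₂)`. Since `[X, Y] = ∂_t` gives `|θ| n ≤ nX + nY`, at least
`|θ| n₂` is left when `θ < 0`, and Heisenberg's inequality for `x` and `∂_x` bounds `n₂` from below.
The resulting factor `1 + |θ|` costs one derivative in `t`: `‖u‖` is estimated by
`‖Lt u‖ + ‖∂_t Lt u‖`, which yields distribution solutions by duality.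
-/

noncomputable section

namespace DoubleChar

section SquareIntegrable

variable {α 𝕜 E : Type*} [MeasurableSpace α] {μ : Measure α} [RCLike 𝕜]

lemma norm_toLp_sq [NormedAddCommGroup E] {f : α → E} (hf : MemLp f 2 μ) :
    ‖hf.toLp f‖ ^ 2 = ∫ x, ‖f x‖ ^ 2 ∂μ := by
  have h0 : 0 ≤ ∫ x, ‖f x‖ ^ 2 ∂μ := integral_nonneg fun _ => by positivity
  rw [Lp.norm_toLp, hf.eLpNorm_eq_integral_rpow_norm (by simp) (by simp)]
  simp only [ENNReal.toReal_ofNat, Real.rpow_ofNat]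
  rw [ENNReal.toReal_ofReal (by positivity), ← Real.rpow_natCast, ← Real.rpow_mul h0]
  norm_num

lemma inner_toLp_toLp [NormedAddCommGroup E] [InnerProductSpace 𝕜 E] {f g : α → E}
    (hf : MemLp f 2 μ) (hg : MemLp g 2 μ) :
    inner 𝕜 (hf.toLp f) (hg.toLp g) = ∫ x, inner 𝕜 (f x) (g x) ∂μ := by
  rw [L2.inner_def]
  refine integral_congr_ae ?_
  filter_upwards [hf.coeFn_toLp, hg.coeFn_toLp] with x hfx hgx
  rw [hfx, hgx]

lemma norm_integral_mul_sq_le {f g : α → 𝕜} (hf : MemLp f 2 μ) (hg : MemLp g 2 μ) :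
    ‖∫ x, f x * g x ∂μ‖ ^ 2 ≤ (∫ x, ‖f x‖ ^ 2 ∂μ) * ∫ x, ‖g x‖ ^ 2 ∂μ := by
  have hinner : inner 𝕜 (hg.star.toLp _) (hf.toLp f) = ∫ x, f x * g x ∂μ := by
    simp [inner_toLp_toLp, RCLike.inner_apply]
  have hg_norm : ‖hg.star.toLp _‖ ^ 2 = ∫ x, ‖g x‖ ^ 2 ∂μ := by
    simpa only [Pi.star_apply, norm_star] using norm_toLp_sq hg.star
  rw [← hinner, ← norm_toLp_sq hf, ← hg_norm, ← mul_pow, mul_comm ‖hf.toLp f‖]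
  gcongr
  exact norm_inner_le_norm _ _

lemma exists_memLp_forall_eq_integral_mul (l : Lp 𝕜 2 μ →L[𝕜] 𝕜) :
    ∃ g : α → 𝕜, MemLp g 2 μ ∧ ∀ (u : α → 𝕜) (hu : MemLp u 2 μ),
      l (hu.toLp u) = ∫ x, u x * g x ∂μ := by
  set v := (InnerProductSpace.toDual 𝕜 (Lp 𝕜 2 μ)).symm l with hv
  refine ⟨star v, (Lp.memLp v).star, fun u hu => ?_⟩
  have h := inner_toLp_toLp (𝕜 := 𝕜) (Lp.memLp v) hu
  rw [Lp.toLp_coeFn, hv, InnerProductSpace.toDual_symm_apply] at h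
  exact h

end SquareIntegrable

section FunctionalAnalysis

variable {𝕜 E H : Type*} [RCLike 𝕜]

lemma exists_continuousLinearMap_comp_eq [AddCommGroup E] [Module 𝕜 E] [NormedAddCommGroup H]
    [NormedSpace 𝕜 H] (M : E →ₗ[𝕜] H) (l : E →ₗ[𝕜] 𝕜) {C : ℝ}
    (hl : ∀ x, ‖l x‖ ≤ C * ‖M x‖) : ∃ Λ : H →L[𝕜] 𝕜, ∀ x, Λ (M x) = l x := by
  obtain ⟨g, hg⟩ := M.rangeRestrict.exists_rightInverse_of_surjective M.range_rangeRestrict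
  have hMg : ∀ y, M (g y) = y := fun y => congrArg Subtype.val (LinearMap.congr_fun hg y)
  obtain ⟨Λ, hΛ, -⟩ := exists_extension_norm_eq (LinearMap.range M)
    ((l ∘ₗ g).mkContinuous C fun y => by simpa [hMg] using hl (g y))
  refine ⟨Λ, fun x => ?_⟩
  have hker : l (g (M.rangeRestrict x) - x) = 0 := by
    simpa [hMg] using hl (g (M.rangeRestrict x) - x)
  rw [map_sub, sub_eq_zero] at hker
  exact (hΛ (M.rangeRestrict x)).trans hker

/- Otherwise the functionals `√n ⟪v n, ·⟫ / ‖v n‖`, of norm `√n`, are pointwise bounded, against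
the Banach-Steinhaus theorem. -/
lemma exists_norm_sq_le_of_eventually_norm_inner_sq_le [NormedAddCommGroup H]
    [InnerProductSpace 𝕜 H] [CompleteSpace H] (v : ℕ → H) {b : ℕ → ℝ} (hb : ∀ n, 0 ≤ b n)
    (h : ∀ f : H, ∃ M : ℝ, 0 ≤ M ∧ ∀ᶠ n in Filter.atTop, ‖inner 𝕜 (v n) f‖ ^ 2 ≤ M * b n) :
    ∃ n : ℕ, ‖v n‖ ^ 2 ≤ n * b n := by
  by_contra! hlt
  have hv : ∀ n, 0 < ‖v n‖ := fun n =>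
    norm_pos_iff.2 fun h0 => (mul_nonneg n.cast_nonneg (hb n)).not_gt (by simpa [h0] using hlt n)
  set G : ℕ → H →L[𝕜] 𝕜 := fun n => ((√n / ‖v n‖ : ℝ) : 𝕜) • innerSL 𝕜 (v n) with hG
  have hG_norm : ∀ n, ‖G n‖ = √n := fun n => by
    simp [hG, norm_smul, abs_of_nonneg, (hv n).ne']
  have hG_bdd : ∀ f, ∃ C, ∀ n, ‖G n f‖ ≤ C := fun f => by
    obtain ⟨M, hM, hfM⟩ := h f
    have hev : ∀ᶠ n in Filter.atTop, ‖G n f‖ ≤ √M := by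
      filter_upwards [hfM] with n hn
      refine Real.le_sqrt_of_sq_le ?_
      calc ‖G n f‖ ^ 2 = n * ‖inner 𝕜 (v n) f‖ ^ 2 / ‖v n‖ ^ 2 := by
            simp [hG, mul_pow, div_pow, div_mul_eq_mul_div]
        _ ≤ M := by
            rw [div_le_iff₀ (pow_pos (hv n) 2)]
            nlinarith [mul_le_mul_of_nonneg_left (hlt n).le hM,
              mul_le_mul_of_nonneg_left hn (n.cast_nonneg (α := ℝ))]
    obtain ⟨C, hC⟩ := (Filter.isBoundedUnder_of_eventually_le hev).bddAbove_range
    exact ⟨C, fun n => hC ⟨n, rfl⟩⟩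
  obtain ⟨C, hC⟩ := banach_steinhaus hG_bdd
  obtain ⟨n, hn⟩ := exists_nat_gt (C ^ 2)
  exact ((hG_norm n).symm.trans_le (hC n)).not_gt (Real.lt_sqrt_of_sq_lt hn)

end FunctionalAnalysis

/-- The vector field `∂_t`, which spans the commutators `[X, Y]`. -/
def T (u : R3 → ℂ) : R3 → ℂ := fun p => fderiv ℝ u p (0, 0, 1)

section Calculus

variable {u v : R3 → ℂ} {k : ℕ} {a : ℝ → ℝ}

lemma X_add (hu : Differentiable ℝ u) (hv : Differentiable ℝ v) :
    X (fun p => u p + v p) = fun p => X u p + X v p := by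
  funext p
  simp [X, fderiv_fun_add (hu p) (hv p)]

lemma Y_add (hu : Differentiable ℝ u) (hv : Differentiable ℝ v) :
    Y k (fun p => u p + v p) = fun p => Y k u p + Y k v p := by
  funext p
  simp [Y, fderiv_fun_add (hu p) (hv p)]

lemma X_const_mul (c : ℂ) (hu : Differentiable ℝ u) :
    X (fun p => c * u p) = fun p => c * X u p := by
  funext p
  simp [X, fderiv_const_mul (hu p)]

lemma Y_const_mul (c : ℂ) (hu : Differentiable ℝ u) :
    Y k (fun p => c * u p) = fun p => c * Y k u p := by
  funext p
  simp [Y, fderiv_const_mul (hu p)]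

lemma Y_eq_fderiv_add_T (p : R3) :
    Y k u p = fderiv ℝ u p (0, 1, 0) + ((p.1 ^ k : ℝ) : ℂ) * T u p := by
  have hvec : ((0, 1, p.1 ^ k) : R3) = (0, 1, 0) + (p.1 ^ k) • (0, 0, 1) := by simp
  rw [Y, hvec, map_add, map_smul, T, Complex.real_smul]

lemma X_Y_eq (hu : ContDiff ℝ ∞ u) (p : R3) :
    X (Y k u) p = fderiv ℝ (fderiv ℝ u) p (1, 0, 0) (0, 1, p.1 ^ k) +
      ((k * p.1 ^ (k - 1) : ℝ) : ℂ) * T u p := by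
  have hdu : DifferentiableAt ℝ (fderiv ℝ u) p :=
    ((hu.fderiv_right (m := ∞) (by simp)).differentiable (by simp)) p
  have hvec : HasFDerivAt (fun q : R3 => ((0, 1, q.1 ^ k) : R3))
      ((0 : R3 →L[ℝ] ℝ).prod ((0 : R3 →L[ℝ] ℝ).prod
        ((k * p.1 ^ (k - 1)) • ContinuousLinearMap.fst ℝ ℝ (ℝ × ℝ)))) p :=
    (hasFDerivAt_const _ _).prodMk ((hasFDerivAt_const _ _).prodMk
      ((hasDerivAt_pow k p.1).comp_hasFDerivAt p hasFDerivAt_fst))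
  have hY : HasFDerivAt (Y k u) _ p := hdu.hasFDerivAt.clm_apply hvec
  have hT : ((0, 0, (k : ℝ) * p.1 ^ (k - 1)) : R3) = (k * p.1 ^ (k - 1) : ℝ) • (0, 0, 1) := by
    simp
  rw [X, hY.fderiv]
  simp only [add_apply, ContinuousLinearMap.comp_apply,
    ContinuousLinearMap.flip_apply, ContinuousLinearMap.prod_apply, smul_apply, zero_apply,
    ContinuousLinearMap.coe_fst', smul_eq_mul, mul_one]
  rw [hT, map_smul, T, Complex.real_smul, add_comm]

lemma Y_X_eq (hu : ContDiff ℝ ∞ u) (p : R3) :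
    Y k (X u) p = fderiv ℝ (fderiv ℝ u) p (0, 1, p.1 ^ k) (1, 0, 0) := by
  have hdu : DifferentiableAt ℝ (fderiv ℝ u) p :=
    ((hu.fderiv_right (m := ∞) (by simp)).differentiable (by simp)) p
  have hX : HasFDerivAt (X u) _ p := hdu.hasFDerivAt.clm_apply (hasFDerivAt_const _ _)
  simp [Y, hX.fderiv]

lemma XY_eq_T (hu : ContDiff ℝ ∞ u) (p : R3) :
    XY k u p = ((k * p.1 ^ (k - 1) : ℝ) : ℂ) * T u p := by
  have hsymm : IsSymmSndFDerivAt ℝ u p := hu.contDiffAt.isSymmSndFDerivAt (by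
    simpa using WithTop.coe_le_coe.2 (le_top : (2 : ℕ∞) ≤ ⊤))
  rw [XY, X_Y_eq hu, Y_X_eq hu, hsymm.eq, add_sub_cancel_left]

lemma L_add (hu : ContDiff ℝ ∞ u) (hv : ContDiff ℝ ∞ v) :
    L k a (fun q => u q + v q) = fun p => L k a u p + L k a v p := by
  have hd {w : R3 → ℂ} (hw : ContDiff ℝ ∞ w) : Differentiable ℝ w := hw.differentiable (by simp)
  funext p
  simp only [L, XY]
  rw [X_add (hd hu) (hd hv), Y_add (hd hu) (hd hv),
    X_add (hd (contDiff_X hu)) (hd (contDiff_X hv)),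
    X_add (hd (contDiff_Y hu)) (hd (contDiff_Y hv)),
    Y_add (hd (contDiff_X hu)) (hd (contDiff_X hv)),
    Y_add (hd (contDiff_Y hu)) (hd (contDiff_Y hv))]
  ring

lemma L_mul (hu : ContDiff ℝ ∞ u) (hv : ContDiff ℝ ∞ v) (p : R3) :
    L k a (fun q => u q * v q) p = u p * L k a v p - 2 * (X u p * X v p)
      - 2 * (Y k u p * Y k v p) + L k a u p * v p := by
  have hd {w : R3 → ℂ} (hw : ContDiff ℝ ∞ w) : Differentiable ℝ w := hw.differentiable (by simp)
  have cX {f : R3 → ℂ} (hf : ContDiff ℝ ∞ f) : ContDiff ℝ ∞ (X f) := contDiff_X hf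
  have cY {f : R3 → ℂ} (hf : ContDiff ℝ ∞ f) : ContDiff ℝ ∞ (Y k f) := contDiff_Y hf
  simp only [L, XY]
  rw [X_mul (hd hu) (hd hv), Y_mul (hd hu) (hd hv),
    X_add (hd (hu.mul (cX hv))) (hd ((cX hu).mul hv)),
    X_add (hd (hu.mul (cY hv))) (hd ((cY hu).mul hv)),
    Y_add (hd (hu.mul (cX hv))) (hd ((cX hu).mul hv)),
    Y_add (hd (hu.mul (cY hv))) (hd ((cY hu).mul hv)),
    X_mul (hd hu) (hd (cX hv)), X_mul (hd (cX hu)) (hd hv),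
    X_mul (hd hu) (hd (cY hv)), X_mul (hd (cY hu)) (hd hv),
    Y_mul (hd hu) (hd (cX hv)), Y_mul (hd (cX hu)) (hd hv),
    Y_mul (hd hu) (hd (cY hv)), Y_mul (hd (cY hu)) (hd hv)]
  ring

lemma L_const_mul (c : ℂ) (hu : ContDiff ℝ ∞ u) :
    L k a (fun q => c * u q) = fun p => c * L k a u p := by
  have hd {w : R3 → ℂ} (hw : ContDiff ℝ ∞ w) : Differentiable ℝ w := hw.differentiable (by simp)
  funext p
  simp only [L, XY]
  rw [X_const_mul c (hd hu), Y_const_mul c (hd hu), X_const_mul c (hd (contDiff_X hu)),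
    X_const_mul c (hd (contDiff_Y hu)), Y_const_mul c (hd (contDiff_X hu)),
    Y_const_mul c (hd (contDiff_Y hu))]
  ring

lemma fderiv_conj {E : Type*} [NormedAddCommGroup E] [NormedSpace ℝ E] {g : E → ℂ} (x w : E) :
    fderiv ℝ (fun q => (starRingEnd ℂ) (g q)) x w = (starRingEnd ℂ) (fderiv ℝ g x w) :=
  DFunLike.congr_fun (Complex.conjCLE.comp_fderiv (f := g) (x := x)) w

lemma Lt_conj (p : R3) :
    Lt k a (fun q => (starRingEnd ℂ) (u q)) p = (starRingEnd ℂ) (Lt k (fun x => -a x) u p) := by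
  have hX (w : R3 → ℂ) : X (fun q => (starRingEnd ℂ) (w q)) = fun q => (starRingEnd ℂ) (X w q) :=
    funext fun q => fderiv_conj q _
  have hY (w : R3 → ℂ) :
      Y k (fun q => (starRingEnd ℂ) (w q)) = fun q => (starRingEnd ℂ) (Y k w q) :=
    funext fun q => fderiv_conj q _
  simp only [Lt, L, XY, hX, hY]
  simp

end Calculus

/-- The test functions `C₀^∞(ℝ³)`, as a predicate on functions rather than as Mathlib's bundled
type, since the operators `X`, `Y`, `L` act on functions. -/
structure IsTest (u : R3 → ℂ) : Prop where
  contDiff : ContDiff ℝ ∞ u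
  hasCompactSupport : HasCompactSupport u

namespace IsTest

variable {u v : R3 → ℂ} {k : ℕ} {a : ℝ → ℝ}

lemma of_testFunction {V : Opens R3} (ψ : 𝓓(V, ℂ)) : IsTest ψ :=
  ⟨ψ.contDiff, ψ.hasCompactSupport⟩

lemma differentiable (hu : IsTest u) : Differentiable ℝ u :=
  hu.contDiff.differentiable (by simp)

lemma memLp (hu : IsTest u) : MemLp u 2 volume :=
  hu.contDiff.continuous.memLp_of_hasCompactSupport hu.hasCompactSupport

lemma fderiv_apply (hu : IsTest u) (w : R3) : IsTest fun p => fderiv ℝ u p w :=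
  ⟨(hu.contDiff.fderiv_right (by simp)).clm_apply contDiff_const,
    hu.hasCompactSupport.fderiv_apply ℝ w⟩

lemma X (hu : IsTest u) : IsTest (X u) := hu.fderiv_apply _

lemma T (hu : IsTest u) : IsTest (T u) := hu.fderiv_apply _

lemma Y (hu : IsTest u) : IsTest (Y k u) :=
  ⟨contDiff_Y hu.contDiff, hasCompactSupport_Y hu.hasCompactSupport⟩

lemma L (ha : ContDiff ℝ ∞ a) (hu : IsTest u) : IsTest (L k a u) :=
  ⟨contDiff_L ha hu.contDiff,
    hu.hasCompactSupport.of_isClosed_subset (isClosed_tsupport _) tsupport_L_subset⟩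

lemma Lt (ha : ContDiff ℝ ∞ a) (hu : IsTest u) : IsTest (Lt k a u) := hu.L ha.neg

lemma mul_left (hv : ContDiff ℝ ∞ v) (hu : IsTest u) : IsTest fun p => v p * u p :=
  ⟨hv.mul hu.contDiff, hu.hasCompactSupport.mul_left⟩

lemma conj (hu : IsTest u) : IsTest fun p => (starRingEnd ℂ) (u p) :=
  ⟨Complex.conjCLE.contDiff.comp hu.contDiff, hu.hasCompactSupport.comp_left (map_zero _)⟩

end IsTest

section Quasimodes

variable {k : ℕ} {a : ℝ → ℝ}

/-- `L` has quasimodes at the origin: no inequality `‖ψ‖² ≤ C ‖Lt ψ‖²` between `L²` norms holds for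
all test functions supported in a given neighbourhood of `0`. -/
def HasQuasimodes (k : ℕ) (a : ℝ → ℝ) : Prop :=
  ∀ ρ > 0, ∀ C : ℝ, ∃ ψ : R3 → ℂ, IsTest ψ ∧ tsupport ψ ⊆ Metric.closedBall 0 ρ ∧
    C * ∫ p, ‖Lt k a ψ p‖ ^ 2 < ∫ p, ‖ψ p‖ ^ 2

lemma HasQuasimodes.of_neg (h : HasQuasimodes k fun x => -a x) :
    HasQuasimodes k a := by
  intro ρ hρ C
  obtain ⟨ψ, hψ, hψρ, hC⟩ := h ρ hρ C
  refine ⟨fun p => (starRingEnd ℂ) (ψ p), hψ.conj, ?_, ?_⟩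
  · refine (closure_mono fun p hp => ?_).trans hψρ
    simpa using hp
  · simpa only [Lt_conj, RCLike.norm_conj] using hC

lemma LocallySolvableL2.exists_norm_integral_mul_sq_le (ha : ContDiff ℝ ∞ a)
    (hsol : LocallySolvableL2 k a) {f : R3 → ℂ} (hf : MemLp f 2 volume) :
    ∃ R > 0, ∃ M : ℝ, 0 ≤ M ∧ ∀ ψ : R3 → ℂ, IsTest ψ → tsupport ψ ⊆ Metric.closedBall 0 R →
      ‖∫ p, f p * ψ p‖ ^ 2 ≤ M * ∫ p, ‖Lt k a ψ p‖ ^ 2 := by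
  obtain ⟨V, hV, u, hu, huf⟩ := hsol f hf
  obtain ⟨R, hR, hRV⟩ := Metric.nhds_basis_closedBall.mem_iff.1 (V.isOpen.mem_nhds hV)
  set K : Set R3 := Metric.closedBall 0 R
  have hKc : IsCompact K := isCompact_closedBall _ _
  have huK : MemLp (K.indicator u) 2 volume :=
    (memLp_indicator_iff_restrict hKc.measurableSet).2 (hu K hKc hRV)
  refine ⟨R, hR, ∫ p, ‖K.indicator u p‖ ^ 2, integral_nonneg fun p => by positivity,
    fun ψ hψ hψK => ?_⟩
  have hLu : ∫ p, f p * ψ p = ∫ p, K.indicator u p * Lt k a ψ p := by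
    let Ψ : 𝓓(V, ℂ) := ⟨ψ, hψ.contDiff, hψ.hasCompactSupport, hψK.trans hRV⟩
    refine (huf Ψ).symm.trans (integral_congr_ae (.of_forall fun p => ?_))
    change u p * Lt k a ψ p = _
    by_cases hp : p ∈ K
    · simp [hp]
    · have hLtψ : Lt k a ψ p = 0 := image_eq_zero_of_notMem_tsupport
        fun h' => hp (hψK (tsupport_L_subset h'))
      simp [hLtψ]
  rw [hLu]
  exact norm_integral_mul_sq_le huK (hψ.Lt ha).memLp

theorem HasQuasimodes.not_locallySolvableL2 (ha : ContDiff ℝ ∞ a) (h : HasQuasimodes k a) :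
    ¬ LocallySolvableL2 k a := by
  intro hsol
  choose ψ hψ hψρ hlt using fun n : ℕ => h (1 / ((n : ℝ) + 1)) Nat.one_div_pos_of_nat n
  let v : ℕ → Lp ℂ 2 (volume : Measure R3) := fun n => (hψ n).conj.memLp.toLp _
  have hv (n : ℕ) : ‖v n‖ ^ 2 = ∫ p, ‖ψ n p‖ ^ 2 := by
    simpa only [RCLike.norm_conj] using norm_toLp_sq (hψ n).conj.memLp
  have hinner (n : ℕ) (f : Lp ℂ 2 (volume : Measure R3)) :
      inner ℂ (v n) f = ∫ p, f p * ψ n p := by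
    have := inner_toLp_toLp (𝕜 := ℂ) (hψ n).conj.memLp (Lp.memLp f)
    simpa [RCLike.inner_apply] using this
  obtain ⟨n, hn⟩ := exists_norm_sq_le_of_eventually_norm_inner_sq_le (𝕜 := ℂ) v
    (b := fun n => ∫ p, ‖Lt k a (ψ n) p‖ ^ 2) (fun n => integral_nonneg fun p => by positivity)
    fun f => by
      obtain ⟨R, hR, M, hM, hfM⟩ := hsol.exists_norm_integral_mul_sq_le ha (Lp.memLp f)
      refine ⟨M, hM, ?_⟩
      filter_upwards [tendsto_one_div_add_atTop_nhds_zero_nat.eventually_le_const hR] with n hn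
      rw [hinner]
      exact hfM _ (hψ n) ((hψρ n).trans (Metric.closedBall_subset_closedBall hn))
  exact (hlt n).not_ge (hv n ▸ hn)

end Quasimodes

instance : (volume : Measure R3).IsAddHaarMeasure :=
  have : (volume : Measure (ℝ × ℝ)).IsAddHaarMeasure :=
    inferInstanceAs ((volume : Measure ℝ).prod (volume : Measure ℝ)).IsAddHaarMeasure
  inferInstanceAs ((volume : Measure ℝ).prod (volume : Measure (ℝ × ℝ))).IsAddHaarMeasure

section LinearChangeOfVariables

variable {E F : Type*} [NormedAddCommGroup E] [NormedSpace ℝ E] [FiniteDimensional ℝ E]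
  {f : E →L[ℝ] E}

lemma det_ne_zero_of_injective (hf : Function.Injective f) : f.det ≠ 0 := fun h =>
  (LinearMap.bot_lt_ker_of_det_eq_zero (f := (f : E →ₗ[ℝ] E)) h).ne' (LinearMap.ker_eq_bot.2 hf)

variable [MeasurableSpace E] [BorelSpace E] {μ : Measure E} [μ.IsAddHaarMeasure]

lemma map_eq_smul_of_injective (hf : Function.Injective f) :
    μ.map f = ENNReal.ofReal |f.det⁻¹| • μ :=
  Measure.map_linearMap_addHaar_eq_smul_addHaar μ (det_ne_zero_of_injective hf)

lemma measurableEmbedding_of_injective (hf : Function.Injective f) : MeasurableEmbedding f :=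
  have := FiniteDimensional.proper_real E
  f.continuous.measurableEmbedding hf

variable [NormedAddCommGroup F] {g : E → F}

lemma integrable_comp_of_injective (hf : Function.Injective f) (hg : Integrable g μ) :
    Integrable (fun x => g (f x)) μ := by
  refine (measurableEmbedding_of_injective hf).integrable_map_iff.1 ?_
  rw [map_eq_smul_of_injective hf]
  exact hg.smul_measure ENNReal.ofReal_ne_top

lemma integral_comp_of_injective [NormedSpace ℝ F] (hf : Function.Injective f) :
    ∫ x, g (f x) ∂μ = |f.det⁻¹| • ∫ x, g x ∂μ := by
  rw [← (measurableEmbedding_of_injective hf).integral_map, map_eq_smul_of_injective hf,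
    integral_smul_measure, ENNReal.toReal_ofReal (abs_nonneg _)]

end LinearChangeOfVariables

section Dilation

variable {u : R3 → ℂ} {k : ℕ} {a : ℝ → ℝ} {r : ℝ}

/-- The dilation `(x, y, t) ↦ (r x, r y, r ^ (k + 1) t)`, for which `X` and `Y` are homogeneous of
degree one. -/
def dilation (k : ℕ) (r : ℝ) : R3 →L[ℝ] R3 :=
  let scale (c : ℝ) : ℝ →L[ℝ] ℝ := c • ContinuousLinearMap.id ℝ ℝ
  (scale r).prodMap ((scale r).prodMap (scale (r ^ (k + 1))))

lemma dilation_apply (p : R3) : dilation k r p = (r * p.1, r * p.2.1, r ^ (k + 1) * p.2.2) := rfl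

lemma dilation_injective (hr : r ≠ 0) : Function.Injective (dilation k r) := fun p q h => by
  simp only [dilation_apply, Prod.mk.injEq, mul_right_inj' hr,
    mul_right_inj' (pow_ne_zero _ hr)] at h
  exact Prod.ext h.1 (Prod.ext h.2.1 h.2.2)

lemma mul_norm_le_norm_dilation (hr : 1 ≤ r) (p : R3) : r * ‖p‖ ≤ ‖dilation k r p‖ := by
  have hr0 : 0 ≤ r := zero_le_one.trans hr
  simp only [dilation_apply, Prod.norm_def, norm_mul, norm_pow, Real.norm_of_nonneg hr0,
    mul_max_of_nonneg _ _ hr0]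
  gcongr
  exact le_self_pow₀ hr k.succ_ne_zero

lemma fderiv_comp_dilation (hu : Differentiable ℝ u) (p v : R3) :
    fderiv ℝ (fun q => u (dilation k r q)) p v =
      fderiv ℝ u (dilation k r p) (dilation k r v) := by
  have h : HasFDerivAt (fun q => u (dilation k r q)) _ p :=
    (hu _).hasFDerivAt.comp p (dilation k r).hasFDerivAt
  rw [h.fderiv, ContinuousLinearMap.comp_apply]

lemma X_comp_dilation (hu : Differentiable ℝ u) :
    X (fun q => u (dilation k r q)) = fun p => r * X u (dilation k r p) := by
  funext p
  have hvec : dilation k r (1, 0, 0) = r • (1, 0, 0) := by simp [dilation_apply]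
  rw [X, fderiv_comp_dilation hu, hvec, map_smul, X, Complex.real_smul]

lemma Y_comp_dilation (hu : Differentiable ℝ u) :
    Y k (fun q => u (dilation k r q)) = fun p => r * Y k u (dilation k r p) := by
  funext p
  have hvec : dilation k r (0, 1, p.1 ^ k) = r • (0, 1, (dilation k r p).1 ^ k) := by
    simp only [dilation_apply, Prod.smul_mk, smul_eq_mul, mul_zero, mul_one, mul_pow]
    ring_nf
  rw [Y, fderiv_comp_dilation hu, hvec, map_smul, Y, Complex.real_smul]

lemma contDiff_comp_dilation (hu : ContDiff ℝ ∞ u) : ContDiff ℝ ∞ fun q => u (dilation k r q) :=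
  hu.comp (dilation k r).contDiff

lemma L_comp_dilation (hu : ContDiff ℝ ∞ u) (p : R3) :
    L k a (fun q => u (dilation k r q)) p =
      r ^ 2 * L k (fun _ => a p.1) u (dilation k r p) := by
  have hd {w : R3 → ℂ} (hw : ContDiff ℝ ∞ w) : Differentiable ℝ w := hw.differentiable (by simp)
  have hX := contDiff_X hu
  have hY := contDiff_Y (k := k) hu
  simp only [L, XY]
  rw [X_comp_dilation (hd hu), Y_comp_dilation (hd hu),
    X_const_mul _ (hd (contDiff_comp_dilation hX)), X_const_mul _ (hd (contDiff_comp_dilation hY)),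
    Y_const_mul _ (hd (contDiff_comp_dilation hX)), Y_const_mul _ (hd (contDiff_comp_dilation hY)),
    X_comp_dilation (hd hX), X_comp_dilation (hd hY), Y_comp_dilation (hd hX),
    Y_comp_dilation (hd hY)]
  ring

end Dilation

section Profile

variable {k : ℕ} {a : ℝ → ℝ} {W χ : R3 → ℂ}

/-- A profile for quasimodes of `L` at the origin: a smooth function, decaying along with its first
derivatives, whose rescalings `W ∘ dilation k r` solve `Lt u = 0` on the unit ball up to an error
of order `1 / r`. The powers of `1 + ‖p‖` make `W` and the error square integrable in dimension `3`,
and leave room for the factor `r²` lost in cutting off. -/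
structure IsProfile (k : ℕ) (a : ℝ → ℝ) (W : R3 → ℂ) : Prop where
  contDiff : ContDiff ℝ ∞ W
  exists_ne_zero : ∃ p, W p ≠ 0
  exists_norm_le : ∃ A, ∀ p, ‖W p‖ ≤ A * (1 + ‖p‖)⁻¹ ^ 4 ∧ ‖X W p‖ ≤ A * (1 + ‖p‖)⁻¹ ^ 4 ∧
    ‖Y k W p‖ ≤ A * (1 + ‖p‖)⁻¹ ^ 4
  exists_norm_Lt_le : ∃ B, ∀ r ≥ 1, ∀ p : R3, ‖p‖ ≤ 1 →
    ‖Lt k a (fun q => W (dilation k r q)) p‖ ≤ B / r * (1 + ‖dilation k r p‖)⁻¹ ^ 2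

/-- A smooth cutoff to the unit ball which is `1` on the ball of radius `σ` about the origin. -/
structure IsCutoff (χ : R3 → ℂ) (σ : ℝ) : Prop where
  isTest : IsTest χ
  norm_le_one : ∀ p, ‖χ p‖ ≤ 1
  tsupport_subset : tsupport χ ⊆ Metric.closedBall 0 1
  eq_one : ∀ p, ‖p‖ < σ → χ p = 1

lemma exists_isCutoff {ρ : ℝ} (hρ : 0 < ρ) :
    ∃ χ : R3 → ℂ, ∃ σ > 0, IsCutoff χ σ ∧ tsupport χ ⊆ Metric.closedBall 0 ρ := by
  have hR : 0 < min ρ 1 := lt_min hρ one_pos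
  let b : ContDiffBump (0 : R3) := ⟨min ρ 1 / 2, min ρ 1, half_pos hR, half_lt_self hR⟩
  have hb : tsupport (fun p => (b p : ℂ)) ⊆ Metric.closedBall 0 (min ρ 1) :=
    (closure_mono fun p hp => by simpa using hp).trans b.tsupport_eq.subset
  refine ⟨fun p => (b p : ℂ), min ρ 1 / 2, half_pos hR, ⟨⟨?_, ?_⟩, fun p => ?_, ?_, fun p hp => ?_⟩,
    hb.trans (Metric.closedBall_subset_closedBall (min_le_left _ _))⟩
  · exact Complex.ofRealCLM.contDiff.comp b.contDiff
  · exact b.hasCompactSupport.comp_left Complex.ofReal_zero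
  · rw [Complex.norm_real, Real.norm_of_nonneg b.nonneg]
    exact b.le_one
  · exact hb.trans (Metric.closedBall_subset_closedBall (min_le_right _ _))
  · rw [b.one_of_mem_closedBall (mem_closedBall_zero_iff.2 hp.le), Complex.ofReal_one]

lemma X_Y_L_eq_zero_of_eventuallyEq_one {p : R3} (h : χ =ᶠ[nhds p] fun _ => 1) :
    X χ p = 0 ∧ Y k χ p = 0 ∧ L k a χ p = 0 := by
  have hX : X χ =ᶠ[nhds p] fun _ => 0 := by
    filter_upwards [h.eventuallyEq_nhds] with q hq
    simp [X, hq.fderiv_eq]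
  have hY : Y k χ =ᶠ[nhds p] fun _ => 0 := by
    filter_upwards [h.eventuallyEq_nhds] with q hq
    simp [Y, hq.fderiv_eq]
  have hXX : X (X χ) p = 0 := by rw [X, hX.fderiv_eq]; simp
  have hXY : X (Y k χ) p = 0 := by rw [X, hY.fderiv_eq]; simp
  have hYX : Y k (X χ) p = 0 := by rw [Y, hX.fderiv_eq]; simp
  have hYY : Y k (Y k χ) p = 0 := by rw [Y, hY.fderiv_eq]; simp
  exact ⟨hX.eq_of_nhds, hY.eq_of_nhds, by simp [L, XY, hXX, hXY, hYX, hYY]⟩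

lemma exists_norm_X_Y_Lt_le_of_isTest (ha : ContDiff ℝ ∞ a) (hχ : IsTest χ) :
    ∃ C, ∀ p, ‖X χ p‖ ≤ C ∧ ‖Y k χ p‖ ≤ C ∧ ‖Lt k a χ p‖ ≤ C := by
  have hbdd {u : R3 → ℂ} (hu : IsTest u) : ∃ C, ∀ p, ‖u p‖ ≤ C :=
    hu.contDiff.continuous.bounded_above_of_compact_support hu.hasCompactSupport
  obtain ⟨C₁, h₁⟩ := hbdd hχ.X
  obtain ⟨C₂, h₂⟩ := hbdd (hχ.Y (k := k))
  obtain ⟨C₃, h₃⟩ := hbdd (hχ.Lt (k := k) ha)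
  exact ⟨max C₁ (max C₂ C₃), fun p => ⟨le_max_of_le_left (h₁ p),
    le_max_of_le_right (le_max_of_le_left (h₂ p)), le_max_of_le_right (le_max_of_le_right (h₃ p))⟩⟩

lemma Lt_cutoff_mul_comp_dilation {r : ℝ} (hχ : ContDiff ℝ ∞ χ) (hW : ContDiff ℝ ∞ W) (p : R3) :
    Lt k a (fun q => χ q * W (dilation k r q)) p =
      χ p * Lt k a (fun q => W (dilation k r q)) p - 2 * (X χ p * (r * X W (dilation k r p)))
        - 2 * (Y k χ p * (r * Y k W (dilation k r p))) + Lt k a χ p * W (dilation k r p) := by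
  have hd : Differentiable ℝ W := hW.differentiable (by simp)
  rw [Lt, L_mul hχ (contDiff_comp_dilation hW), X_comp_dilation hd, Y_comp_dilation hd]
  rfl

lemma IsCutoff.exists_norm_X_Y_Lt_le_dilation (ha : ContDiff ℝ ∞ a) {σ : ℝ} (hσ : 0 < σ)
    (hχ : IsCutoff χ σ) : ∃ C ≥ 0, ∀ r ≥ 1, ∀ p, ‖X χ p‖ ≤ C * (‖dilation k r p‖ / r) ^ 2 ∧
      ‖Y k χ p‖ ≤ C * (‖dilation k r p‖ / r) ^ 2 ∧
      ‖Lt k a χ p‖ ≤ C * (‖dilation k r p‖ / r) ^ 2 := by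
  obtain ⟨C, hC⟩ := exists_norm_X_Y_Lt_le_of_isTest (k := k) ha hχ.isTest
  have hC0 : 0 ≤ C := (norm_nonneg _).trans (hC 0).1
  refine ⟨C / σ ^ 2, by positivity, fun r hr p => ?_⟩
  rcases lt_or_ge ‖p‖ σ with hp | hp
  · have hone : χ =ᶠ[nhds p] fun _ => 1 :=
      (continuous_norm.continuousAt.eventually_lt_const hp).mono hχ.eq_one
    obtain ⟨hX, hY, -⟩ := X_Y_L_eq_zero_of_eventuallyEq_one (k := k) (a := a) hone
    have hL : Lt k a χ p = 0 := (X_Y_L_eq_zero_of_eventuallyEq_one hone).2.2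
    simp only [hX, hY, hL, norm_zero, and_self]
    positivity
  · have hσr : σ ≤ ‖dilation k r p‖ / r :=
      hp.trans <| (le_div_iff₀' (one_pos.trans_le hr)).2 (mul_norm_le_norm_dilation hr p)
    have hCσ : C ≤ C / σ ^ 2 * (‖dilation k r p‖ / r) ^ 2 := by
      rw [div_mul_eq_mul_div, le_div_iff₀ (by positivity)]
      gcongr
    exact ⟨(hC p).1.trans hCσ, (hC p).2.1.trans hCσ, (hC p).2.2.trans hCσ⟩

lemma IsCutoff.norm_mul_le {σ c : ℝ} {z : ℂ} {p : R3} (hχ : IsCutoff χ σ) (hc : 0 ≤ c)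
    (hz : ‖p‖ ≤ 1 → ‖z‖ ≤ c) : ‖χ p * z‖ ≤ c := by
  by_cases hp : p ∈ tsupport χ
  · rw [norm_mul]
    exact (mul_le_of_le_one_left (norm_nonneg _) (hχ.norm_le_one p)).trans
      (hz (mem_closedBall_zero_iff.1 (hχ.tsupport_subset hp)))
  · rwa [image_eq_zero_of_notMem_tsupport hp, zero_mul, norm_zero]

/-- The cutoff costs `(‖dilation k r p‖ / r)²`, which two of the four powers in the decay of the
profile turn into `1 / r²`: enough to absorb the factor `r` produced by `X` and `Y`. -/
lemma IsProfile.exists_norm_Lt_cutoff_mul_le (ha : ContDiff ℝ ∞ a) (hW : IsProfile k a W) {σ : ℝ}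
    (hσ : 0 < σ) (hχ : IsCutoff χ σ) :
    ∃ D, ∀ r ≥ 1, ∀ p, ‖Lt k a (fun q => χ q * W (dilation k r q)) p‖ ≤
      D / r * (1 + ‖dilation k r p‖)⁻¹ ^ 2 := by
  obtain ⟨A, hA⟩ := hW.exists_norm_le
  obtain ⟨B, hB⟩ := hW.exists_norm_Lt_le
  obtain ⟨C, hC0, hC⟩ := hχ.exists_norm_X_Y_Lt_le_dilation (k := k) ha hσ
  have hA0 : 0 ≤ A := by simpa using (norm_nonneg _).trans (hA 0).1
  have hB0 : 0 ≤ B := by simpa using (norm_nonneg _).trans (hB 1 le_rfl 0 (by simp))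
  refine ⟨B + 5 * C * A, fun r hr p => ?_⟩
  have hr0 : 0 < r := one_pos.trans_le hr
  obtain ⟨hX, hY, hL⟩ := hC r hr p
  obtain ⟨hW0, hWX, hWY⟩ := hA (dilation k r p)
  set d : ℝ := ‖dilation k r p‖
  have hd0 : 0 ≤ d := norm_nonneg _
  have hmain : ‖χ p * Lt k a (fun q => W (dilation k r q)) p‖ ≤ B / r * (1 + d)⁻¹ ^ 2 :=
    hχ.norm_mul_le (by positivity) (hB r hr p)
  have hdd : (d / r) ^ 2 * (r * (1 + d)⁻¹ ^ 4) ≤ (1 + d)⁻¹ ^ 2 / r := by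
    calc (d / r) ^ 2 * (r * (1 + d)⁻¹ ^ 4) ≤ ((1 + d) / r) ^ 2 * (r * (1 + d)⁻¹ ^ 4) := by
          gcongr
          linarith
      _ = (1 + d)⁻¹ ^ 2 / r := by field_simp
  rw [Lt_cutoff_mul_comp_dilation hχ.isTest.contDiff hW.contDiff]
  calc _ ≤ B / r * (1 + d)⁻¹ ^ 2 + 2 * (C * (d / r) ^ 2 * (r * (A * (1 + d)⁻¹ ^ 4)))
        + 2 * (C * (d / r) ^ 2 * (r * (A * (1 + d)⁻¹ ^ 4)))
        + C * (d / r) ^ 2 * (r * (A * (1 + d)⁻¹ ^ 4)) := by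
        refine (norm_add_le_of_le (norm_sub_le_of_le (norm_sub_le_of_le hmain ?_) ?_) ?_)
        · rw [norm_mul, norm_mul, norm_mul, Complex.norm_ofNat, Complex.norm_of_nonneg hr0.le]
          gcongr
        · rw [norm_mul, norm_mul, norm_mul, Complex.norm_ofNat, Complex.norm_of_nonneg hr0.le]
          gcongr
        · rw [norm_mul]
          gcongr
          exact hW0.trans (le_mul_of_one_le_left (by positivity) hr)
    _ = B / r * (1 + d)⁻¹ ^ 2 + 5 * C * A * ((d / r) ^ 2 * (r * (1 + d)⁻¹ ^ 4)) := by ring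
    _ ≤ B / r * (1 + d)⁻¹ ^ 2 + 5 * C * A * ((1 + d)⁻¹ ^ 2 / r) := by gcongr
    _ = (B + 5 * C * A) / r * (1 + d)⁻¹ ^ 2 := by ring

lemma IsProfile.exists_setIntegral_pos (hW : IsProfile k a W) :
    ∃ R, 0 < ∫ p in Metric.ball 0 R, ‖W p‖ ^ 2 := by
  obtain ⟨p₀, hp₀⟩ := hW.exists_ne_zero
  have hcont : Continuous fun p => ‖W p‖ ^ 2 := hW.contDiff.continuous.norm.pow 2
  refine ⟨‖p₀‖ + 1, ?_⟩
  rw [setIntegral_pos_iff_support_of_nonneg_ae (.of_forall fun p => by positivity)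
    ((hcont.locallyIntegrable.integrableOn_isCompact (isCompact_closedBall 0 (‖p₀‖ + 1))).mono_set
      Metric.ball_subset_closedBall)]
  exact (hcont.isOpen_support.inter Metric.isOpen_ball).measure_pos _
    ⟨p₀, by simpa using hp₀, by simp⟩

lemma IsCutoff.setIntegral_le_integral_norm_sq {σ r R : ℝ} (hχ : IsCutoff χ σ) (hr : 1 ≤ r)
    (hR : R ≤ r * σ) (hW : ContDiff ℝ ∞ W) :
    |(dilation k r).det⁻¹| * ∫ p in Metric.ball 0 R, ‖W p‖ ^ 2 ≤
      ∫ p, ‖χ p * W (dilation k r p)‖ ^ 2 := by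
  have hψ : IsTest fun p => W (dilation k r p) * χ p :=
    hχ.isTest.mul_left (contDiff_comp_dilation hW)
  rw [← integral_indicator Metric.isOpen_ball.measurableSet, ← smul_eq_mul,
    ← integral_comp_of_injective (dilation_injective (one_pos.trans_le hr).ne')]
  refine integral_mono_of_nonneg (.of_forall fun p => Set.indicator_nonneg (by simp) _)
    (by simpa only [mul_comm] using hψ.memLp.norm.integrable_sq) (.of_forall fun p => ?_)
  by_cases hp : dilation k r p ∈ Metric.ball 0 R
  · have hpσ : ‖p‖ < σ := lt_of_mul_lt_mul_left ((mul_norm_le_norm_dilation hr p).trans_lt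
      ((mem_ball_zero_iff.1 hp).trans_le hR)) (zero_le_one.trans hr)
    simp [hp, hχ.eq_one p hpσ]
  · simp only [Set.indicator_of_notMem hp]
    positivity

lemma integral_norm_sq_comp_dilation_le {u : R3 → ℂ} {r c : ℝ} (hr : r ≠ 0)
    (hu : ∀ p, ‖u p‖ ≤ c * (1 + ‖dilation k r p‖)⁻¹ ^ 2) :
    ∫ p, ‖u p‖ ^ 2 ≤ |(dilation k r).det⁻¹| * (c ^ 2 * ∫ p : R3, (1 + ‖p‖)⁻¹ ^ 4) := by
  have hδ := dilation_injective (k := k) hr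
  have hint : Integrable fun p : R3 => c ^ 2 * (1 + ‖p‖)⁻¹ ^ 4 := by
    have h := integrable_one_add_norm (E := R3) (μ := volume) (r := 4) (by norm_num)
    simpa only [Real.rpow_neg (add_nonneg zero_le_one (norm_nonneg _)), Real.rpow_ofNat,
      inv_pow] using h.const_mul (c ^ 2)
  rw [← integral_const_mul, ← smul_eq_mul, ← integral_comp_of_injective hδ]
  refine integral_mono_of_nonneg (.of_forall fun p => by positivity)
    (integrable_comp_of_injective hδ hint) (.of_forall fun p => ?_)
  refine (pow_le_pow_left₀ (norm_nonneg _) (hu p) 2).trans_eq ?_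
  ring

/-- Rescaled cut-off profiles `ψ` are quasimodes: up to the Jacobian of the dilation, the squared
`L²` norm of `Lt ψ` is `O(1 / r²)` while that of `ψ` is bounded below. -/
theorem IsProfile.hasQuasimodes (ha : ContDiff ℝ ∞ a) (hW : IsProfile k a W) :
    HasQuasimodes k a := by
  intro ρ hρ C
  obtain ⟨χ, σ, hσ, hχ, hχρ⟩ := exists_isCutoff hρ
  obtain ⟨D, hD⟩ := hW.exists_norm_Lt_cutoff_mul_le ha hσ hχ
  obtain ⟨R, hm⟩ := hW.exists_setIntegral_pos
  set m := ∫ p in Metric.ball 0 R, ‖W p‖ ^ 2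
  set S := ∫ p : R3, (1 + ‖p‖)⁻¹ ^ 4
  have hlim : Filter.Tendsto (fun r : ℝ => |C| * ((D / r) ^ 2 * S)) Filter.atTop (nhds 0) := by
    simpa using (((tendsto_const_nhds (x := D)).div_atTop Filter.tendsto_id).pow 2
      |>.mul_const S).const_mul |C|
  obtain ⟨r, hrm, hr1, hrR⟩ := ((hlim.eventually_lt_const hm).and
    ((Filter.eventually_ge_atTop 1).and (Filter.eventually_ge_atTop (R / σ)))).exists
  have hr0 : r ≠ 0 := (one_pos.trans_le hr1).ne'
  set J := |(dilation k r).det⁻¹|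
  have hJ : 0 < J := abs_pos.2 (inv_ne_zero (det_ne_zero_of_injective (dilation_injective hr0)))
  refine ⟨fun p => χ p * W (dilation k r p), ?_, tsupport_mul_subset_left.trans hχρ, ?_⟩
  · simpa only [mul_comm] using hχ.isTest.mul_left (contDiff_comp_dilation (r := r) hW.contDiff)
  calc C * ∫ p, ‖Lt k a (fun p => χ p * W (dilation k r p)) p‖ ^ 2
      ≤ |C| * (J * ((D / r) ^ 2 * S)) := by
        gcongr
        · exact le_abs_self C
        · exact integral_norm_sq_comp_dilation_le hr0 (hD r hr1)
    _ = J * (|C| * ((D / r) ^ 2 * S)) := by ring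
    _ < J * m := by gcongr
    _ ≤ ∫ p, ‖χ p * W (dilation k r p)‖ ^ 2 :=
        hχ.setIntegral_le_integral_norm_sq hr1 ((div_le_iff₀ hσ).1 hrR) hW.contDiff

end Profile

section Model

variable {k m N : ℕ} {a : ℝ → ℝ}

/-- The antiholomorphic coordinate `x - i y`. -/
def zbar (p : R3) : ℂ := p.1 - Complex.I * p.2.1

/-- A function with positive real part which is annihilated by `X + i Y`. -/
def zeta (k : ℕ) (p : R3) : ℂ :=
  2 + (p.1 : ℂ) ^ (k + 1) / (k + 1) - ((p.1 : ℂ) + Complex.I * p.2.1) ^ 2 / 4 + Complex.I * p.2.2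

/-- The derivative `X (zeta k)`. -/
def Xzeta (k : ℕ) (p : R3) : ℂ := (p.1 : ℂ) ^ k - ((p.1 : ℂ) + Complex.I * p.2.1) / 2

/-- An exact solution of `Lt u = 0` if `a` is constant equal to `2 m + 1` and `k = 1` or `m = 0`;
the exponent `N` governs its decay. -/
def model (k m N : ℕ) (p : R3) : ℂ := zbar p ^ m * (zeta k p)⁻¹ ^ N

lemma contDiff_zbar : ContDiff ℝ ∞ zbar :=
  (Complex.ofRealCLM.contDiff.comp contDiff_fst).sub
    (contDiff_const.mul (Complex.ofRealCLM.contDiff.comp (contDiff_fst.comp contDiff_snd)))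

lemma contDiff_zeta : ContDiff ℝ ∞ (zeta k) := by
  have hx : ContDiff ℝ ∞ fun p : R3 => (p.1 : ℂ) := Complex.ofRealCLM.contDiff.comp contDiff_fst
  have hy : ContDiff ℝ ∞ fun p : R3 => (p.2.1 : ℂ) :=
    Complex.ofRealCLM.contDiff.comp (contDiff_fst.comp contDiff_snd)
  have ht : ContDiff ℝ ∞ fun p : R3 => (p.2.2 : ℂ) :=
    Complex.ofRealCLM.contDiff.comp (contDiff_snd.comp contDiff_snd)
  exact ((contDiff_const.add ((hx.pow _).div_const _)).sub
    (((hx.add (contDiff_const.mul hy)).pow 2).div_const _)).add (contDiff_const.mul ht)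

lemma fderiv_eq_of_hasDerivAt {E F : Type*} [NormedAddCommGroup E] [NormedSpace ℝ E]
    [NormedAddCommGroup F] [NormedSpace ℝ F] {u : E → F} {p v : E} {d : F}
    (hu : DifferentiableAt ℝ u p) (h : HasDerivAt (fun s : ℝ => u (p + s • v)) d 0) :
    fderiv ℝ u p v = d := by
  rw [← hu.lineDeriv_eq_fderiv]
  exact HasLineDerivAt.lineDeriv h

lemma hasDerivAt_ofReal_add_mul (x b : ℝ) :
    HasDerivAt (fun s : ℝ => ((x + s * b : ℝ) : ℂ)) b 0 := by
  have : HasDerivAt (fun s : ℝ => x + s * b) b 0 := by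
    simpa using ((hasDerivAt_id (0 : ℝ)).mul_const b).const_add x
  exact this.ofReal_comp

lemma fderiv_zbar (p v : R3) : fderiv ℝ zbar p v = v.1 - Complex.I * v.2.1 :=
  fderiv_eq_of_hasDerivAt (contDiff_zbar.differentiable (by simp) p)
    ((hasDerivAt_ofReal_add_mul p.1 v.1).sub
      ((hasDerivAt_ofReal_add_mul p.2.1 v.2.1).const_mul _))

lemma fderiv_zeta (p v : R3) : fderiv ℝ (zeta k) p v =
    (p.1 : ℂ) ^ k * v.1 - ((p.1 : ℂ) + Complex.I * p.2.1) / 2 * (v.1 + Complex.I * v.2.1)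
      + Complex.I * v.2.2 := by
  refine fderiv_eq_of_hasDerivAt (contDiff_zeta.differentiable (by simp) p) ?_
  have hx := hasDerivAt_ofReal_add_mul p.1 v.1
  have hy := hasDerivAt_ofReal_add_mul p.2.1 v.2.1
  have ht := hasDerivAt_ofReal_add_mul p.2.2 v.2.2
  have h := ((((hx.pow (k + 1)).div_const ((k : ℂ) + 1)).const_add 2).sub
    (((hx.add (hy.const_mul Complex.I)).pow 2).div_const 4)).add (ht.const_mul Complex.I)
  refine HasDerivAt.congr_deriv h ?_
  have hk : (k : ℂ) + 1 ≠ 0 := by exact_mod_cast k.succ_ne_zero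
  simp only [Complex.ofReal_add, Complex.ofReal_mul, Pi.add_apply, Complex.ofReal_zero, zero_mul,
    add_zero, add_tsub_cancel_right, Nat.cast_add, Nat.cast_one, Nat.cast_ofNat]
  field_simp
  ring

lemma X_zeta (p : R3) : X (zeta k) p = Xzeta k p := by
  rw [X, fderiv_zeta, Xzeta]
  simp

lemma Y_zeta (p : R3) : Y k (zeta k) p = Complex.I * Xzeta k p := by
  rw [Y, fderiv_zeta, Xzeta]
  push_cast
  ring

lemma sq_div_two_sub_le_pow_succ_div (hk : Odd k) (s : ℝ) :
    s ^ 2 / 2 - 1 / 2 ≤ s ^ (k + 1) / (k + 1) := by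
  obtain ⟨n, rfl⟩ := hk
  have hbernoulli := one_add_mul_le_pow (a := s ^ 2 - 1) (by nlinarith [sq_nonneg s]) (n + 1)
  have hpow : (1 + (s ^ 2 - 1)) ^ (n + 1) = s ^ (2 * n + 1 + 1) := by
    rw [add_sub_cancel, ← pow_mul, mul_add, mul_one]
  rw [hpow] at hbernoulli
  rw [le_div_iff₀ (by positivity)]
  push_cast at hbernoulli ⊢
  nlinarith

lemma zeta_eq (p : R3) : zeta k p =
    ((2 + p.1 ^ (k + 1) / (k + 1) - (p.1 ^ 2 - p.2.1 ^ 2) / 4 : ℝ) : ℂ)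
      + ((p.2.2 - p.1 * p.2.1 / 2 : ℝ) : ℂ) * Complex.I := by
  rw [zeta]
  push_cast
  linear_combination (-(p.2.1 : ℂ) ^ 2 / 4) * Complex.I_sq

lemma zeta_re (p : R3) :
    (zeta k p).re = 2 + p.1 ^ (k + 1) / (k + 1) - (p.1 ^ 2 - p.2.1 ^ 2) / 4 := by
  rw [zeta_eq, Complex.add_re, Complex.re_ofReal_mul, Complex.ofReal_re, Complex.I_re, mul_zero,
    add_zero]

lemma zeta_im (p : R3) : (zeta k p).im = p.2.2 - p.1 * p.2.1 / 2 := by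
  rw [zeta_eq, Complex.add_im, Complex.im_ofReal_mul, Complex.ofReal_im, Complex.I_im, mul_one,
    zero_add]

lemma le_norm_zeta (hk : Odd k) (p : R3) : 3 / 2 + (p.1 ^ 2 + p.2.1 ^ 2) / 4 ≤ ‖zeta k p‖ := by
  refine le_trans ?_ (Complex.re_le_norm _)
  rw [zeta_re]
  nlinarith [sq_div_two_sub_le_pow_succ_div hk p.1]

lemma one_le_norm_zeta (hk : Odd k) (p : R3) : 1 ≤ ‖zeta k p‖ := by
  nlinarith [le_norm_zeta hk p, sq_nonneg p.1, sq_nonneg p.2.1]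

lemma zeta_ne_zero (hk : Odd k) (p : R3) : zeta k p ≠ 0 :=
  norm_pos_iff.1 (one_pos.trans_le (one_le_norm_zeta hk p))

lemma contDiff_model (hk : Odd k) : ContDiff ℝ ∞ (model k m N) :=
  (contDiff_zbar.pow m).mul ((contDiff_zeta.inv (zeta_ne_zero hk)).pow N)

lemma fderiv_model (hk : Odd k) (p v : R3) : fderiv ℝ (model k m N) p v =
    m * zbar p ^ (m - 1) * (zeta k p)⁻¹ ^ N * fderiv ℝ zbar p v
      - N * zbar p ^ m * (zeta k p)⁻¹ ^ (N + 1) * fderiv ℝ (zeta k) p v := by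
  have hzbar : HasFDerivAt zbar _ p := (contDiff_zbar.differentiable (by simp) p).hasFDerivAt
  have hzeta : HasFDerivAt (zeta k) _ p := (contDiff_zeta.differentiable (by simp) p).hasFDerivAt
  refine fderiv_eq_of_hasDerivAt ((contDiff_model hk).differentiable (by simp) p) ?_
  refine (((hzbar.hasLineDerivAt v).pow m).mul
    (((hzeta.hasLineDerivAt v).inv (zeta_ne_zero hk _)).pow N)).congr_deriv ?_
  have hz := zeta_ne_zero hk p
  rcases N with _ | N
  · simp
  · simp only [Nat.add_sub_cancel, pow_succ, Pi.inv_apply, Pi.pow_apply, zero_smul, add_zero]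
    push_cast
    field_simp
    ring

lemma X_model (hk : Odd k) (p : R3) : X (model k m N) p =
    m * zbar p ^ (m - 1) * (zeta k p)⁻¹ ^ N
      - N * zbar p ^ m * (zeta k p)⁻¹ ^ (N + 1) * Xzeta k p := by
  rw [X, fderiv_model hk, fderiv_zbar, ← X, X_zeta]
  simp

lemma Y_model (hk : Odd k) (p : R3) : Y k (model k m N) p =
    -Complex.I * (m * zbar p ^ (m - 1) * (zeta k p)⁻¹ ^ N
      + N * zbar p ^ m * (zeta k p)⁻¹ ^ (N + 1) * Xzeta k p) := by
  rw [Y, fderiv_model hk, fderiv_zbar, ← Y, Y_zeta]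
  push_cast
  ring

lemma T_model (hk : Odd k) (p : R3) : T (model k m N) p =
    -Complex.I * N * zbar p ^ m * (zeta k p)⁻¹ ^ (N + 1) := by
  rw [T, fderiv_model hk, fderiv_zeta, fderiv_zbar]
  simp only [Complex.ofReal_zero, Complex.ofReal_one, mul_zero, mul_one, add_zero, sub_self,
    zero_sub, zero_add]
  ring

lemma X_add_I_mul_Y_model (hk : Odd k) (p : R3) :
    X (model k m N) p + Complex.I * Y k (model k m N) p = 2 * m * model k (m - 1) N p := by
  rw [X_model hk, Y_model hk, model]
  linear_combination (-(m * zbar p ^ (m - 1) * (zeta k p)⁻¹ ^ N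
    + N * zbar p ^ m * (zeta k p)⁻¹ ^ (N + 1) * Xzeta k p)) * Complex.I_sq

lemma L_eq_factored {u : R3 → ℂ} (hu : ContDiff ℝ ∞ u) (p : R3) :
    L k a u p = -(X (fun q => X u q + Complex.I * Y k u q) p
      - Complex.I * Y k (fun q => X u q + Complex.I * Y k u q) p)
      + Complex.I * (1 + a p.1) * XY k u p := by
  have hX : Differentiable ℝ (X u) := (contDiff_X hu).differentiable (by simp)
  have hY : Differentiable ℝ (Y k u) := (contDiff_Y hu).differentiable (by simp)
  rw [X_add hX (hY.const_mul _), Y_add hX (hY.const_mul _), X_const_mul _ hY, Y_const_mul _ hY]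
  simp only [L, XY]
  linear_combination (-Y k (Y k u) p) * Complex.I_sq

lemma Lt_model (hk : Odd k) (hkm : k = 1 ∨ m = 0) (p : R3) : Lt k a (model k m N) p =
    ((2 * m + 1 - a p.1) * (k * p.1 ^ (k - 1)) * N : ℝ) *
      (zbar p ^ m * (zeta k p)⁻¹ ^ (N + 1)) := by
  have hd : Differentiable ℝ (model k (m - 1) N) := (contDiff_model hk).differentiable (by simp)
  rw [Lt, L_eq_factored (contDiff_model hk), funext (X_add_I_mul_Y_model hk), X_const_mul _ hd,
    Y_const_mul _ hd, XY_eq_T (contDiff_model hk), T_model hk]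
  simp only [X_model hk, Y_model hk]
  rcases hkm with rfl | rfl
  · have hXzeta : Xzeta 1 p = zbar p / 2 := by
      rw [Xzeta, zbar]
      ring
    rw [hXzeta]
    rcases m with _ | m
    · push_cast
      linear_combination (-(N * (1 - a p.1) * (zeta 1 p)⁻¹ ^ (N + 1) : ℂ)) * Complex.I_sq
    · simp only [Nat.add_sub_cancel]
      push_cast
      linear_combination (N * zbar p ^ (m + 1) * (zeta 1 p)⁻¹ ^ (N + 1) * (a p.1 - 2 - m)
        - 2 * (m + 1) * m * zbar p ^ (m - 1) * (zeta 1 p)⁻¹ ^ N) * Complex.I_sq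
  · push_cast
    linear_combination ((zeta k p)⁻¹ ^ (N + 1) * N * k * p.1 ^ (k - 1) * (a p.1 - 1)) *
      Complex.I_sq

end Model

section ModelBounds

variable {k m N : ℕ} {a : ℝ → ℝ}

lemma norm_zbar_sq (p : R3) : ‖zbar p‖ ^ 2 = p.1 ^ 2 + p.2.1 ^ 2 := by
  have : zbar p = (p.1 : ℂ) + ((-p.2.1 : ℝ) : ℂ) * Complex.I := by
    rw [zbar]
    push_cast
    ring
  rw [this, ← Complex.normSq_eq_norm_sq, Complex.normSq_add_mul_I, neg_sq]

lemma norm_zbar_le (hk : Odd k) (p : R3) : ‖zbar p‖ ≤ 2 * ‖zeta k p‖ := by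
  refine abs_le_of_sq_le_sq' ?_ (by positivity) |>.2
  rw [norm_zbar_sq]
  nlinarith [le_norm_zeta hk p, one_le_norm_zeta hk p]

lemma norm_le_two_mul_norm_zeta (hk : Odd k) (p : R3) : ‖p‖ ≤ 2 * ‖zeta k p‖ := by
  have hxy := norm_zbar_le hk p
  have hx : |p.1| ≤ ‖zbar p‖ := abs_le_of_sq_le_sq
    (by rw [norm_zbar_sq]; exact le_add_of_nonneg_right (sq_nonneg _)) (norm_nonneg _)
  have hy : |p.2.1| ≤ ‖zbar p‖ := abs_le_of_sq_le_sq
    (by rw [norm_zbar_sq]; exact le_add_of_nonneg_left (sq_nonneg _)) (norm_nonneg _)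
  have ht : |p.2.2| ≤ 2 * ‖zeta k p‖ := by
    have him := Complex.abs_im_le_norm (zeta k p)
    rw [zeta_im, abs_le] at him
    rw [abs_le]
    constructor <;>
      nlinarith [le_norm_zeta hk p, sq_nonneg (p.1 - p.2.1), sq_nonneg (p.1 + p.2.1)]
  exact max_le (hx.trans hxy) (max_le (hy.trans hxy) ht)

lemma inv_norm_zeta_le (hk : Odd k) (p : R3) : ‖zeta k p‖⁻¹ ≤ 3 * (1 + ‖p‖)⁻¹ := by
  have hs := one_le_norm_zeta hk p
  rw [← div_eq_mul_inv, le_div_iff₀ (by positivity), inv_mul_le_iff₀ (by positivity)]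
  linarith [norm_le_two_mul_norm_zeta hk p]

lemma norm_Xzeta_le (hk : Odd k) (p : R3) : ‖Xzeta k p‖ ≤ 2 * (2 * ‖zeta k p‖) ^ k := by
  have hconj : Xzeta k p = (p.1 : ℂ) ^ k - (starRingEnd ℂ) (zbar p) / 2 := by
    simp only [Xzeta, zbar, map_sub, map_mul, Complex.conj_ofReal, Complex.conj_I]
    ring
  have hpow : ‖(p.1 : ℂ) ^ k‖ ≤ (2 * ‖zeta k p‖) ^ k := by
    rw [norm_pow, Complex.norm_real]
    gcongr
    exact (norm_fst_le p).trans (norm_le_two_mul_norm_zeta hk p)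
  have hlin : ‖(starRingEnd ℂ) (zbar p) / 2‖ ≤ (2 * ‖zeta k p‖) ^ k := by
    rw [norm_div, RCLike.norm_conj, Complex.norm_ofNat]
    have hself : 2 * ‖zeta k p‖ ≤ (2 * ‖zeta k p‖) ^ k :=
      le_self_pow₀ (by linarith [one_le_norm_zeta hk p]) hk.pos.ne'
    linarith [norm_zbar_le hk p, norm_nonneg (zbar p)]
  rw [hconj, two_mul ((2 * ‖zeta k p‖) ^ k)]
  exact (norm_sub_le _ _).trans (add_le_add hpow hlin)

lemma two_mul_pow_mul_inv_pow {s : ℝ} (hs : s ≠ 0) (i j : ℕ) :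
    (2 * s) ^ i * s⁻¹ ^ (i + j) = 2 ^ i * s⁻¹ ^ j := by
  rw [mul_pow, pow_add, mul_assoc, ← mul_assoc (s ^ i), ← mul_pow, mul_inv_cancel₀ hs, one_pow,
    one_mul]

lemma norm_zbar_pow_mul_inv_pow_le (hk : Odd k) (p : R3) (i j : ℕ) {n : ℕ} (hn : i + j ≤ n) :
    ‖zbar p‖ ^ i * ‖zeta k p‖⁻¹ ^ n ≤ 2 ^ i * ‖zeta k p‖⁻¹ ^ j := by
  have hs := one_le_norm_zeta hk p
  rw [← two_mul_pow_mul_inv_pow (by positivity) i j]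
  exact mul_le_mul (pow_le_pow_left₀ (norm_nonneg _) (norm_zbar_le hk p) _)
    (pow_le_pow_of_le_one (by positivity) (inv_le_one_of_one_le₀ hs) hn) (by positivity)
    (by positivity)

lemma norm_model_le (hk : Odd k) (p : R3) :
    ‖model k m (m + k + 4) p‖ ≤ 2 ^ m * ‖zeta k p‖⁻¹ ^ 4 := by
  rw [model, norm_mul, norm_pow, norm_pow, norm_inv]
  exact norm_zbar_pow_mul_inv_pow_le hk p m 4 (by omega)

lemma norm_deriv_model_terms_le (hk : Odd k) (p : R3) :
    ‖(m * zbar p ^ (m - 1) * (zeta k p)⁻¹ ^ (m + k + 4) : ℂ)‖ +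
      ‖((m + k + 4 : ℕ) * zbar p ^ m * (zeta k p)⁻¹ ^ (m + k + 4 + 1) * Xzeta k p : ℂ)‖ ≤
    (m * 2 ^ (m - 1) + 2 * (m + k + 4) * 2 ^ (m + k)) * ‖zeta k p‖⁻¹ ^ 4 := by
  have hs := one_le_norm_zeta hk p
  simp only [norm_mul, norm_pow, norm_inv, Complex.norm_natCast]
  have hfirst := norm_zbar_pow_mul_inv_pow_le hk p (m - 1) 4 (n := m + k + 4) (by omega)
  have hsecond : ‖zbar p‖ ^ m * ‖zeta k p‖⁻¹ ^ (m + k + 4 + 1) * ‖Xzeta k p‖ ≤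
      2 * 2 ^ (m + k) * ‖zeta k p‖⁻¹ ^ 4 :=
    calc _ ≤ 2 ^ m * ‖zeta k p‖⁻¹ ^ (k + 4) * (2 * (2 * ‖zeta k p‖) ^ k) :=
          mul_le_mul (norm_zbar_pow_mul_inv_pow_le hk p m (k + 4) (by omega)) (norm_Xzeta_le hk p)
            (norm_nonneg _) (by positivity)
      _ = 2 * 2 ^ m * ((2 * ‖zeta k p‖) ^ k * ‖zeta k p‖⁻¹ ^ (k + 4)) := by ring
      _ = _ := by rw [two_mul_pow_mul_inv_pow (by positivity)]; ring
  calc _ = m * (‖zbar p‖ ^ (m - 1) * ‖zeta k p‖⁻¹ ^ (m + k + 4)) + ((m + k + 4 : ℕ) : ℝ) *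
        (‖zbar p‖ ^ m * ‖zeta k p‖⁻¹ ^ (m + k + 4 + 1) * ‖Xzeta k p‖) := by ring
    _ ≤ m * (2 ^ (m - 1) * ‖zeta k p‖⁻¹ ^ 4) +
        ((m + k + 4 : ℕ) : ℝ) * (2 * 2 ^ (m + k) * ‖zeta k p‖⁻¹ ^ 4) := by gcongr
    _ = _ := by push_cast; ring

lemma norm_X_model_le (hk : Odd k) (p : R3) : ‖X (model k m (m + k + 4)) p‖ ≤
    (m * 2 ^ (m - 1) + 2 * (m + k + 4) * 2 ^ (m + k)) * ‖zeta k p‖⁻¹ ^ 4 := by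
  rw [X_model hk]
  exact (norm_sub_le _ _).trans (norm_deriv_model_terms_le hk p)

lemma norm_Y_model_le (hk : Odd k) (p : R3) : ‖Y k (model k m (m + k + 4)) p‖ ≤
    (m * 2 ^ (m - 1) + 2 * (m + k + 4) * 2 ^ (m + k)) * ‖zeta k p‖⁻¹ ^ 4 := by
  rw [Y_model hk, norm_mul, norm_neg, Complex.norm_I, one_mul]
  exact (norm_add_le _ _).trans (norm_deriv_model_terms_le hk p)

lemma norm_Lt_model_le (hk : Odd k) (hkm : k = 1 ∨ m = 0) (p : R3) :
    ‖Lt k a (model k m (m + k + 4)) p‖ ≤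
      k * (m + k + 4) * 2 ^ (m + k) * |2 * m + 1 - a p.1| * ‖zeta k p‖⁻¹ ^ 5 := by
  have hs := one_le_norm_zeta hk p
  rw [Lt_model hk hkm, norm_mul, norm_mul, norm_pow, norm_pow, norm_inv, Complex.norm_real]
  simp only [norm_mul, norm_pow, Real.norm_eq_abs, Nat.abs_cast]
  have hx : |p.1| ^ (k - 1) ≤ (2 * ‖zeta k p‖) ^ k :=
    (pow_le_pow_left₀ (abs_nonneg _)
      ((norm_fst_le p).trans (norm_le_two_mul_norm_zeta hk p)) _).trans
        (pow_le_pow_right₀ (by linarith) (k.sub_le 1))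
  have hz := norm_zbar_pow_mul_inv_pow_le hk p m (k + 5) (n := m + k + 4 + 1) (by omega)
  calc _ ≤ |2 * m + 1 - a p.1| * (k * (2 * ‖zeta k p‖) ^ k) * ((m + k + 4 : ℕ) : ℝ) *
        (2 ^ m * ‖zeta k p‖⁻¹ ^ (k + 5)) := by gcongr
    _ = k * (m + k + 4) * 2 ^ m * |2 * m + 1 - a p.1| *
        ((2 * ‖zeta k p‖) ^ k * ‖zeta k p‖⁻¹ ^ (k + 5)) := by push_cast; ring
    _ = _ := by rw [two_mul_pow_mul_inv_pow (by positivity)]; ring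

end ModelBounds

section Flatness

variable {f : ℝ → ℝ} {M : ℝ} {n : ℕ}

lemma abs_le_of_abs_deriv_le (hf : Differentiable ℝ f) (h0 : f 0 = 0) (hM : 0 ≤ M)
    (h : ∀ x, |x| ≤ 1 → |deriv f x| ≤ M * |x| ^ n) (x : ℝ) (hx : |x| ≤ 1) :
    |f x| ≤ M * |x| ^ (n + 1) := by
  have hderiv : ∀ y ∈ Set.Icc (-|x|) |x|, ‖deriv f y‖ ≤ M * |x| ^ n := fun y hy => by
    have hyx : |y| ≤ |x| := abs_le.2 hy
    exact (h y (hyx.trans hx)).trans (by gcongr)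
  have hmean := (convex_Icc (-|x|) |x|).norm_image_sub_le_of_norm_deriv_le (fun y _ => hf y) hderiv
    (x := 0) (y := x) (by simp) ⟨neg_abs_le x, le_abs_self x⟩
  rw [h0, sub_zero, sub_zero, mul_assoc, Real.norm_eq_abs, Real.norm_eq_abs, ← pow_succ] at hmean
  exact hmean

lemma exists_abs_sub_le_mul_cube {a : ℝ → ℝ} (ha : ContDiff ℝ ∞ a) (h1 : iteratedDeriv 1 a 0 = 0)
    (h2 : iteratedDeriv 2 a 0 = 0) : ∃ M ≥ 0, ∀ x, |x| ≤ 1 → |a x - a 0| ≤ M * |x| ^ 3 := by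
  have hd1 : ContDiff ℝ ∞ (deriv a) := ContDiff.deriv' (n := ∞) (by simpa using ha)
  have hd2 : ContDiff ℝ ∞ (deriv (deriv a)) := ContDiff.deriv' (n := ∞) (by simpa using hd1)
  have hd3 : ContDiff ℝ ∞ (deriv (deriv (deriv a))) :=
    ContDiff.deriv' (n := ∞) (by simpa using hd2)
  have hd {g : ℝ → ℝ} (hg : ContDiff ℝ ∞ g) : Differentiable ℝ g := hg.differentiable (by simp)
  obtain ⟨M, hM⟩ := (isCompact_Icc (a := (-1 : ℝ)) (b := 1)).exists_bound_of_continuousOn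
    hd3.continuous.continuousOn
  have hM0 : 0 ≤ M := (norm_nonneg _).trans (hM 0 (by simp))
  have hbound2 := abs_le_of_abs_deriv_le (n := 0) (hd hd2) (by simpa [iteratedDeriv_succ] using h2)
    hM0 fun x hx => by simpa using hM x (abs_le.1 hx)
  have hbound1 := abs_le_of_abs_deriv_le (hd hd1) (by simpa using h1) hM0 hbound2
  exact ⟨M, hM0, abs_le_of_abs_deriv_le (f := fun x => a x - a 0) ((hd ha).sub_const _) (by simp)
    hM0 fun x hx => by simpa only [deriv_sub_const] using hbound1 x hx⟩

end Flatness

section NotLocallySolvable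

variable {k m : ℕ} {a : ℝ → ℝ}

lemma norm_Lt_model_comp_dilation_le (hk : Odd k) (hkm : k = 1 ∨ m = 0) {M r : ℝ} (hM0 : 0 ≤ M)
    (hr : 0 < r) {p : R3} (hM : |2 * m + 1 - a p.1| ≤ M * |p.1| ^ 3) :
    ‖Lt k a (fun q => model k m (m + k + 4) (dilation k r q)) p‖ ≤
      k * (m + k + 4) * 2 ^ (m + k) * M * 8 / r * ‖zeta k (dilation k r p)‖⁻¹ ^ 2 := by
  have hs := one_le_norm_zeta hk (dilation k r p)
  set s := ‖zeta k (dilation k r p)‖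
  have hx : r * |p.1| ≤ 2 * s := by
    rw [← abs_of_pos hr, ← abs_mul]
    exact (norm_fst_le (dilation k r p)).trans (norm_le_two_mul_norm_zeta hk _)
  have hmodel := norm_Lt_model_le (a := fun _ => a p.1) hk hkm (dilation k r p)
  rw [Lt, L_comp_dilation (contDiff_model hk), norm_mul, norm_pow, Complex.norm_real,
    Real.norm_of_nonneg hr.le]
  have hcoeff : r ^ 2 * |2 * m + 1 - a p.1| ≤ M * (8 * s ^ 3) / r := by
    calc r ^ 2 * |2 * m + 1 - a p.1| ≤ r ^ 2 * (M * |p.1| ^ 3) := by gcongr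
      _ = M * (r * |p.1|) ^ 3 / r := by field_simp
      _ ≤ M * (2 * s) ^ 3 / r := by gcongr
      _ = M * (8 * s ^ 3) / r := by ring
  calc _ ≤ r ^ 2 * (k * (m + k + 4) * 2 ^ (m + k) * |2 * m + 1 - a p.1| * s⁻¹ ^ 5) := by
        gcongr
        exact hmodel
    _ = k * (m + k + 4) * 2 ^ (m + k) * (r ^ 2 * |2 * m + 1 - a p.1|) * s⁻¹ ^ 5 := by ring
    _ ≤ k * (m + k + 4) * 2 ^ (m + k) * (M * (8 * s ^ 3) / r) * s⁻¹ ^ 5 := by gcongr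
    _ = _ := by
      field_simp

lemma isProfile_model (hk : Odd k) (hkm : k = 1 ∨ m = 0) (ha : ContDiff ℝ ∞ a)
    (h0 : a 0 = 2 * m + 1) (h1 : iteratedDeriv 1 a 0 = 0) (h2 : iteratedDeriv 2 a 0 = 0) :
    IsProfile k a (model k m (m + k + 4)) where
  contDiff := contDiff_model hk
  exists_ne_zero := ⟨(1, 0, 0), mul_ne_zero (pow_ne_zero _ (by simp [zbar]))
    (pow_ne_zero _ (inv_ne_zero (zeta_ne_zero hk _)))⟩
  exists_norm_le := by
    refine ⟨(2 ^ m + (m * 2 ^ (m - 1) + 2 * (m + k + 4) * 2 ^ (m + k))) * 3 ^ 4, fun p => ?_⟩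
    have hzeta : ‖zeta k p‖⁻¹ ^ 4 ≤ 3 ^ 4 * (1 + ‖p‖)⁻¹ ^ 4 := by
      rw [← mul_pow]
      exact pow_le_pow_left₀ (by positivity) (inv_norm_zeta_le hk p) 4
    have hle {b c : ℝ} (hc : 0 ≤ c) (h : b ≤ c * ‖zeta k p‖⁻¹ ^ 4)
        (hcC : c ≤ 2 ^ m + (m * 2 ^ (m - 1) + 2 * (m + k + 4) * 2 ^ (m + k))) :
        b ≤ (2 ^ m + (m * 2 ^ (m - 1) + 2 * (m + k + 4) * 2 ^ (m + k))) * 3 ^ 4 *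
          (1 + ‖p‖)⁻¹ ^ 4 := by
      rw [mul_assoc]
      exact h.trans (mul_le_mul hcC hzeta (by positivity) (hc.trans hcC))
    exact ⟨hle (by positivity) (norm_model_le hk p) (le_add_of_nonneg_right (by positivity)),
      hle (by positivity) (norm_X_model_le hk p) (le_add_of_nonneg_left (by positivity)),
      hle (by positivity) (norm_Y_model_le hk p) (le_add_of_nonneg_left (by positivity))⟩
  exists_norm_Lt_le := by
    obtain ⟨M, hM0, hM⟩ := exists_abs_sub_le_mul_cube ha h1 h2
    refine ⟨k * (m + k + 4) * 2 ^ (m + k) * M * 8 * 3 ^ 2, fun r hr p hp => ?_⟩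
    have hr0 : 0 < r := one_pos.trans_le hr
    have hcoeff : |2 * m + 1 - a p.1| ≤ M * |p.1| ^ 3 := by
      rw [← h0, abs_sub_comm]
      exact hM _ ((norm_fst_le p).trans hp)
    calc _ ≤ _ := norm_Lt_model_comp_dilation_le hk hkm hM0 hr0 hcoeff
      _ ≤ k * (m + k + 4) * 2 ^ (m + k) * M * 8 / r * (3 * (1 + ‖dilation k r p‖)⁻¹) ^ 2 := by
        gcongr
        exact inv_norm_zeta_le hk _
      _ = _ := by ring

lemma exists_eq_two_mul_add_one_of_odd {m : ℤ} (hm : Odd m) :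
    ∃ n : ℕ, m = 2 * n + 1 ∨ -m = 2 * n + 1 := by
  obtain ⟨j, rfl⟩ := hm
  rcases le_or_gt 0 j with hj | hj
  · exact ⟨j.toNat, by omega⟩
  · exact ⟨(-j - 1).toNat, by omega⟩

lemma exists_eigenvalue_index {b : ℝ}
    (h : (k = 1 ∧ ∃ m : ℤ, Odd m ∧ b = m) ∨ (1 < k ∧ Odd k ∧ (b = 1 ∨ b = -1))) :
    ∃ m : ℕ, (k = 1 ∨ m = 0) ∧ (b = 2 * m + 1 ∨ -b = 2 * m + 1) := by
  rcases h with ⟨hk, m, hm, rfl⟩ | ⟨-, -, hb⟩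
  · obtain ⟨n, hn⟩ := exists_eq_two_mul_add_one_of_odd hm
    exact ⟨n, Or.inl hk, by exact_mod_cast hn⟩
  · exact ⟨0, Or.inr rfl, by simpa [neg_eq_iff_eq_neg] using hb⟩

theorem not_locallySolvableL2 (ha : ContDiff ℝ ∞ a)
    (h : (k = 1 ∧ ∃ m : ℤ, Odd m ∧ a 0 = m) ∨ (1 < k ∧ Odd k ∧ (a 0 = 1 ∨ a 0 = -1)))
    (h1 : iteratedDeriv 1 a 0 = 0) (h2 : iteratedDeriv 2 a 0 = 0) : ¬ LocallySolvableL2 k a := by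
  have hk : Odd k := by
    rcases h with ⟨rfl, -⟩ | ⟨-, hk, -⟩
    exacts [odd_one, hk]
  obtain ⟨m, hkm, hm | hm⟩ := exists_eigenvalue_index h
  · exact ((isProfile_model hk hkm ha hm h1 h2).hasQuasimodes ha).not_locallySolvableL2 ha
  · have hprofile : IsProfile k (fun x => -a x) (model k m (m + k + 4)) :=
      isProfile_model hk hkm ha.neg hm (by rw [iteratedDeriv_fun_neg, h1, neg_zero])
        (by rw [iteratedDeriv_fun_neg, h2, neg_zero])
    exact (HasQuasimodes.of_neg (hprofile.hasQuasimodes ha.neg)).not_locallySolvableL2 ha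

end NotLocallySolvable

section ParametricIntegral

open scoped Convolution

variable {E : Type*} [NormedAddCommGroup E] [NormedSpace ℝ E]

/-- Differentiation under the integral sign is borrowed from convolutions with parameters: the
integral is the value at `0` of the convolution of `f` with the reflection of `g (q, ·)`. -/
lemma hasFDerivAt_integral_mul {f : ℝ → ℂ} (hf : LocallyIntegrable f) {g : E × ℝ → ℂ}
    (hg : ContDiff ℝ 1 g) (hgs : HasCompactSupport g) (q : E) :
    ∃ D : E →L[ℝ] ℂ, HasFDerivAt (fun q => ∫ t, f t * g (q, t)) D q ∧
      ∀ v, D v = ∫ t, f t * fderiv ℝ g (q, t) (v, 0) := by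
  let A : (E × ℝ) ≃L[ℝ] (E × ℝ) := (ContinuousLinearEquiv.refl ℝ E).prodCongr (.neg ℝ)
  let h : E → ℝ → ℂ := fun q t => g (A (q, t))
  have hh : ContDiff ℝ 1 (↿h : E × ℝ → ℂ) := hg.comp A.contDiff
  have hhs : HasCompactSupport (↿h : E × ℝ → ℂ) := hgs.comp_homeomorph A.toHomeomorph
  have hh0 (q : E) (t : ℝ) (ht : t ∉ Prod.snd '' tsupport (↿h : E × ℝ → ℂ)) : h q t = 0 :=
    image_eq_zero_of_notMem_tsupport (f := (↿h : E × ℝ → ℂ)) fun hmem => ht ⟨(q, t), hmem, rfl⟩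
  have hconv : (fun q => ∫ t, f t * g (q, t)) =
      fun q => (f ⋆[ContinuousLinearMap.mul ℝ ℂ] h q) 0 := by
    funext q
    simp [convolution_def, h, A]
  have hD : HasFDerivAt (fun q => (f ⋆[ContinuousLinearMap.mul ℝ ℂ] h q) 0) _ q :=
    (hasFDerivAt_convolution_right_with_param (ContinuousLinearMap.mul ℝ ℂ) isOpen_univ
      (hhs.isCompact.image continuous_snd) (fun q t _ => hh0 q t) hf hh.contDiffOn
      (q, 0) trivial).comp (f := fun q => (q, (0 : ℝ))) q
      ((hasFDerivAt_id q).prodMk (hasFDerivAt_const (0 : ℝ) q))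
  refine ⟨_, hconv ▸ hD, fun v => ?_⟩
  have hcont : Continuous fun t => fderiv ℝ (↿h : E × ℝ → ℂ) (q, t) :=
    (hh.continuous_fderiv (by simp)).comp (by fun_prop)
  have hsupp : HasCompactSupport fun t => fderiv ℝ (↿h : E × ℝ → ℂ) (q, t) :=
    (hhs.fderiv ℝ).comp_isClosedEmbedding <| Function.LeftInverse.isClosedEmbedding
      (f := Prod.snd) (fun _ => rfl) (by fun_prop) (by fun_prop)
  rw [ContinuousLinearMap.comp_apply, convolution_precompR_apply _ hf hsupp hcont, convolution_def]
  have hfderiv (t : ℝ) : fderiv ℝ (↿h : E × ℝ → ℂ) (q, t) =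
      (fderiv ℝ g (A (q, t))).comp (A : E × ℝ →L[ℝ] E × ℝ) :=
    A.comp_right_fderiv
  simp [hfderiv, A]

end ParametricIntegral

section PartialFourier

open scoped FourierTransform

variable {u v : R3 → ℂ} {τ : ℝ}

lemma IsTest.exists_forall_eq_zero_of_lt_norm (hu : IsTest u) :
    ∃ R : ℝ, ∀ p : R3, R < ‖p‖ → u p = 0 := by
  obtain ⟨R, hR⟩ := hu.hasCompactSupport.isCompact.isBounded.exists_norm_le
  exact ⟨R, fun p hp => image_eq_zero_of_notMem_tsupport fun hmem => hp.not_ge (hR p hmem)⟩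

lemma norm_le_norm_slice (q : ℝ × ℝ) (t : ℝ) :
    ‖q‖ ≤ ‖((q.1, q.2, t) : R3)‖ ∧ ‖t‖ ≤ ‖((q.1, q.2, t) : R3)‖ := by
  simp only [Prod.norm_def]
  exact ⟨max_le_max le_rfl (le_max_left _ _), (le_max_right _ _).trans (le_max_right _ _)⟩

lemma IsTest.contDiff_slice (hu : IsTest u) (q : ℝ × ℝ) :
    ContDiff ℝ ∞ fun t => u (q.1, q.2, t) :=
  hu.contDiff.comp (contDiff_const.prodMk (contDiff_const.prodMk contDiff_id))

lemma IsTest.hasCompactSupport_slice (hu : IsTest u) (q : ℝ × ℝ) :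
    HasCompactSupport fun t => u (q.1, q.2, t) :=
  hu.hasCompactSupport.comp_isClosedEmbedding <|
    Function.LeftInverse.isClosedEmbedding (f := fun p : R3 => p.2.2) (fun _ => rfl)
      (by fun_prop) (by fun_prop)

lemma IsTest.integrable_slice (hu : IsTest u) (q : ℝ × ℝ) :
    Integrable fun t => u (q.1, q.2, t) :=
  (hu.contDiff_slice q).continuous.integrable_of_hasCompactSupport (hu.hasCompactSupport_slice q)

/-- The partial Fourier transform in the variable `t`, at the frequency `τ` and normalised as in
Mathlib with the kernel `exp (-2πitτ)`. It turns `∂_t` into multiplication by `2πiτ`. -/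
def partialFourier (τ : ℝ) (u : R3 → ℂ) (q : ℝ × ℝ) : ℂ := 𝓕 (fun t => u (q.1, q.2, t)) τ

/-- The kernel `exp (-2πitτ)` of the Fourier transform. -/
def fourierKernel (τ t : ℝ) : ℂ := Complex.exp (((-2 * Real.pi * t * τ : ℝ) : ℂ) * Complex.I)

lemma continuous_fourierKernel : Continuous fun z : ℝ × ℝ => fourierKernel z.1 z.2 := by
  unfold fourierKernel
  fun_prop

lemma continuous_fourierKernel_right : Continuous (fourierKernel τ) :=
  continuous_fourierKernel.comp (continuous_const.prodMk continuous_id)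

lemma partialFourier_eq (τ : ℝ) (u : R3 → ℂ) (q : ℝ × ℝ) :
    partialFourier τ u q = ∫ t, fourierKernel τ t * u (q.1, q.2, t) :=
  Real.fourier_real_eq_integral_exp_smul _ _

lemma IsTest.integrable_fourierKernel_mul (hu : IsTest u) (q : ℝ × ℝ) :
    Integrable fun t => fourierKernel τ t * u (q.1, q.2, t) :=
  (continuous_fourierKernel_right.mul
    (hu.contDiff_slice q).continuous).integrable_of_hasCompactSupport
      (hu.hasCompactSupport_slice q).mul_left

lemma partialFourier_add (hu : IsTest u) (hv : IsTest v) (q : ℝ × ℝ) :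
    partialFourier τ (fun p => u p + v p) q = partialFourier τ u q + partialFourier τ v q := by
  simp only [partialFourier_eq, mul_add]
  exact integral_add (hu.integrable_fourierKernel_mul q) (hv.integrable_fourierKernel_mul q)

lemma partialFourier_const_mul (c : ℂ) (q : ℝ × ℝ) :
    partialFourier τ (fun p => c * u p) q = c * partialFourier τ u q := by
  simp only [partialFourier_eq, mul_left_comm _ c, integral_const_mul]

lemma partialFourier_coord_mul (f : ℝ → ℝ) (q : ℝ × ℝ) :
    partialFourier τ (fun p => (f p.1 : ℂ) * u p) q = f q.1 * partialFourier τ u q := by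
  simp only [partialFourier_eq, mul_left_comm _ (f q.1 : ℂ), integral_const_mul]

lemma continuous_partialFourier (hu : IsTest u) :
    Continuous fun z : ℝ × ℝ × ℝ => partialFourier z.1 u z.2 := by
  obtain ⟨R, hR⟩ := hu.exists_forall_eq_zero_of_lt_norm
  have heq (z : ℝ × ℝ × ℝ) : partialFourier z.1 u z.2 =
      ∫ t in Metric.closedBall 0 R, fourierKernel z.1 t * u (z.2.1, z.2.2, t) := by
    rw [partialFourier_eq, setIntegral_eq_integral_of_forall_compl_eq_zero fun t ht => ?_]
    rw [mem_closedBall_zero_iff, not_le] at ht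
    rw [hR _ (ht.trans_le (norm_le_norm_slice z.2 t).2), mul_zero]
  simp_rw [heq]
  refine continuous_parametric_integral_of_continuous ?_ (isCompact_closedBall _ _)
  have hu_cont := hu.contDiff.continuous
  have he_cont := continuous_fourierKernel
  simp only [Function.uncurry_def]
  fun_prop

lemma hasCompactSupport_partialFourier (hu : IsTest u) :
    HasCompactSupport (partialFourier τ u) := by
  obtain ⟨R, hR⟩ := hu.exists_forall_eq_zero_of_lt_norm
  refine .of_support_subset_isCompact (isCompact_closedBall (0 : ℝ × ℝ) R) fun q hq => ?_
  rw [mem_closedBall_zero_iff]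
  by_contra! h
  have hslice (t : ℝ) : u (q.1, q.2, t) = 0 := hR _ (h.trans_le (norm_le_norm_slice q t).1)
  exact hq (by simp [partialFourier_eq, hslice])

lemma memLp_partialFourier (hu : IsTest u) : MemLp (partialFourier τ u) 2 volume :=
  ((continuous_partialFourier hu).comp
    (continuous_const.prodMk continuous_id)).memLp_of_hasCompactSupport
      (hasCompactSupport_partialFourier hu)

lemma hasFDerivAt_partialFourier (hu : IsTest u) (q : ℝ × ℝ) :
    ∃ D : ℝ × ℝ →L[ℝ] ℂ, HasFDerivAt (partialFourier τ u) D q ∧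
      ∀ v, D v = partialFourier τ (fun p => fderiv ℝ u p (v.1, v.2, 0)) q := by
  let A : ((ℝ × ℝ) × ℝ) ≃L[ℝ] R3 := ContinuousLinearEquiv.prodAssoc ℝ ℝ ℝ ℝ
  obtain ⟨D, hD, hDv⟩ := hasFDerivAt_integral_mul (g := u ∘ A)
    (continuous_fourierKernel_right (τ := τ)).locallyIntegrable
    ((hu.contDiff.comp A.contDiff).of_le (by simp))
    (hu.hasCompactSupport.comp_homeomorph A.toHomeomorph) q
  have hpF : partialFourier τ u = fun q => ∫ t, fourierKernel τ t * (u ∘ A) (q, t) :=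
    funext fun q => partialFourier_eq τ u q
  refine ⟨D, hpF ▸ hD, fun v => ?_⟩
  simp only [hDv, A.comp_right_fderiv, partialFourier_eq]
  rfl

lemma differentiable_partialFourier (hu : IsTest u) : Differentiable ℝ (partialFourier τ u) :=
  fun q => (hasFDerivAt_partialFourier hu q).choose_spec.1.differentiableAt

lemma fderiv_partialFourier (hu : IsTest u) (q v : ℝ × ℝ) : fderiv ℝ (partialFourier τ u) q v =
    partialFourier τ (fun p => fderiv ℝ u p (v.1, v.2, 0)) q := by
  obtain ⟨D, hD, hDv⟩ := hasFDerivAt_partialFourier (τ := τ) hu q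
  rw [hD.fderiv, hDv]

lemma partialFourier_T (hu : IsTest u) (q : ℝ × ℝ) :
    partialFourier τ (T u) q = ((2 * Real.pi * τ : ℝ) : ℂ) * Complex.I * partialFourier τ u q := by
  have hderiv : (fun t => T u (q.1, q.2, t)) = deriv fun t => u (q.1, q.2, t) := by
    funext t
    have hslice : HasDerivAt (fun t : ℝ => ((q.1, q.2, t) : R3)) (0, 0, 1) t :=
      (hasDerivAt_const t q.1).prodMk ((hasDerivAt_const t q.2).prodMk (hasDerivAt_id t))
    exact ((hu.differentiable _).hasFDerivAt.comp_hasDerivAt t hslice).deriv.symm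
  rw [partialFourier, hderiv, Real.fourier_deriv (hu.integrable_slice q)
    ((hu.contDiff_slice q).differentiable (by simp)) (hderiv ▸ hu.T.integrable_slice q),
    partialFourier]
  push_cast
  rw [smul_eq_mul]
  ring

lemma lintegral_norm_sq_partialFourier_eq_slice (hu : IsTest u) (q : ℝ × ℝ) :
    ∫⁻ τ, ENNReal.ofReal (‖partialFourier τ u q‖ ^ 2) =
      ∫⁻ t, ENNReal.ofReal (‖u (q.1, q.2, t)‖ ^ 2) := by
  have integrable_sq (f : SchwartzMap ℝ ℂ) : Integrable fun t => ‖f t‖ ^ 2 :=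
    (memLp_two_iff_integrable_sq_norm f.continuous.aestronglyMeasurable).1 (f.memLp 2)
  have hplancherel := congrArg ENNReal.ofReal (SchwartzMap.integral_norm_sq_fourier
    ((hu.hasCompactSupport_slice q).toSchwartzMap (hu.contDiff_slice q)))
  rwa [ofReal_integral_eq_lintegral_ofReal (integrable_sq _) (.of_forall fun _ => by positivity),
    ofReal_integral_eq_lintegral_ofReal (integrable_sq _)
      (.of_forall fun _ => by positivity)] at hplancherel

lemma lintegral_eq_lintegral_slice {F : R3 → ENNReal} (hF : Measurable F) :
    ∫⁻ p, F p = ∫⁻ q : ℝ × ℝ, ∫⁻ t, F (q.1, q.2, t) := by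
  rw [← (volume_preserving_prodAssoc (α₁ := ℝ) (β₁ := ℝ) (γ₁ := ℝ)).lintegral_comp hF,
    Measure.volume_eq_prod (ℝ × ℝ) ℝ,
    lintegral_prod (fun z => F (MeasurableEquiv.prodAssoc z))
      (hF.comp MeasurableEquiv.prodAssoc.measurable).aemeasurable]
  rfl

theorem lintegral_lintegral_norm_sq_partialFourier (hu : IsTest u) :
    ∫⁻ τ, ∫⁻ q, ENNReal.ofReal (‖partialFourier τ u q‖ ^ 2) =
      ∫⁻ p, ENNReal.ofReal (‖u p‖ ^ 2) := by
  have hmeas : Measurable fun z : ℝ × ℝ × ℝ => ENNReal.ofReal (‖partialFourier z.1 u z.2‖ ^ 2) :=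
    (ENNReal.continuous_ofReal.comp ((continuous_partialFourier hu).norm.pow 2)).measurable
  have hmeas_u : Measurable fun p => ENNReal.ofReal (‖u p‖ ^ 2) :=
    (ENNReal.continuous_ofReal.comp (hu.contDiff.continuous.norm.pow 2)).measurable
  rw [lintegral_lintegral_swap (f := fun τ q => ENNReal.ofReal (‖partialFourier τ u q‖ ^ 2))
    hmeas.aemeasurable, lintegral_eq_lintegral_slice hmeas_u]
  exact lintegral_congr fun q => lintegral_norm_sq_partialFourier_eq_slice hu q

end PartialFourier

/-- The inner product `∫ û v̂⋆` in `L²(ℝ²)` of the partial Fourier transforms at frequency `τ`,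
linear in `u`. The fields `X` and `Y` are skew for it, and `∂_t` acts as the scalar `2πiτ`. -/
def fourierInner (τ : ℝ) (u v : R3 → ℂ) : ℂ :=
  ∫ q, partialFourier τ u q * (starRingEnd ℂ) (partialFourier τ v q)

/-- The squared norm in `L²(ℝ²)` of the partial Fourier transform at frequency `τ`. -/
def fourierNormSq (τ : ℝ) (u : R3 → ℂ) : ℝ := ∫ q, ‖partialFourier τ u q‖ ^ 2

section FourierInner

variable {u v w : R3 → ℂ} {k : ℕ} {τ : ℝ}

lemma IsTest.add (hu : IsTest u) (hv : IsTest v) : IsTest fun p => u p + v p :=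
  ⟨hu.contDiff.add hv.contDiff, hu.hasCompactSupport.add hv.hasCompactSupport⟩

lemma IsTest.const_mul (c : ℂ) (hu : IsTest u) : IsTest fun p => c * u p :=
  hu.mul_left contDiff_const

lemma contDiff_coord {f : ℝ → ℝ} (hf : ContDiff ℝ ∞ f) :
    ContDiff ℝ ∞ fun p : R3 => (f p.1 : ℂ) :=
  Complex.ofRealCLM.contDiff.comp (hf.comp contDiff_fst)

lemma IsTest.coord_mul {f : ℝ → ℝ} (hf : ContDiff ℝ ∞ f) (hu : IsTest u) :
    IsTest fun p => (f p.1 : ℂ) * u p :=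
  hu.mul_left (contDiff_coord hf)

lemma integrable_partialFourier_mul_conj (hu : IsTest u) (hv : IsTest v) :
    Integrable fun q => partialFourier τ u q * (starRingEnd ℂ) (partialFourier τ v q) :=
  (memLp_partialFourier hu).integrable_mul (memLp_partialFourier hv).star

lemma integrable_norm_sq_partialFourier (hu : IsTest u) :
    Integrable fun q => ‖partialFourier τ u q‖ ^ 2 :=
  (memLp_two_iff_integrable_sq_norm (memLp_partialFourier hu).1).1 (memLp_partialFourier hu)

lemma fourierNormSq_nonneg : 0 ≤ fourierNormSq τ u := integral_nonneg fun _ => by positivity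

lemma fourierInner_self : fourierInner τ u u = fourierNormSq τ u := by
  simp only [fourierInner, fourierNormSq, Complex.mul_conj, Complex.normSq_eq_norm_sq,
    integral_complex_ofReal]

lemma conj_fourierInner : (starRingEnd ℂ) (fourierInner τ u v) = fourierInner τ v u := by
  simp only [fourierInner, ← integral_conj, map_mul, Complex.conj_conj, mul_comm]

lemma norm_fourierInner_sq_le (hu : IsTest u) (hv : IsTest v) :
    ‖fourierInner τ u v‖ ^ 2 ≤ fourierNormSq τ u * fourierNormSq τ v := by
  simpa only [fourierInner, fourierNormSq, Pi.star_apply, RCLike.star_def, RCLike.norm_conj] using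
    norm_integral_mul_sq_le (memLp_partialFourier hu) (memLp_partialFourier (τ := τ) hv).star

lemma fourierInner_add_left (hu : IsTest u) (hv : IsTest v) (hw : IsTest w) :
    fourierInner τ (fun p => u p + v p) w = fourierInner τ u w + fourierInner τ v w := by
  simp only [fourierInner, partialFourier_add hu hv, add_mul]
  exact integral_add (integrable_partialFourier_mul_conj hu hw)
    (integrable_partialFourier_mul_conj hv hw)

lemma fourierInner_add_right (hu : IsTest u) (hv : IsTest v) (hw : IsTest w) :
    fourierInner τ u (fun p => v p + w p) = fourierInner τ u v + fourierInner τ u w := by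
  rw [← conj_fourierInner, fourierInner_add_left hv hw hu, map_add, conj_fourierInner,
    conj_fourierInner]

lemma fourierInner_const_mul_left (c : ℂ) :
    fourierInner τ (fun p => c * u p) v = c * fourierInner τ u v := by
  simp only [fourierInner, partialFourier_const_mul, mul_assoc, integral_const_mul]

lemma fourierInner_coord_mul (f : ℝ → ℝ) :
    fourierInner τ (fun p => (f p.1 : ℂ) * u p) v =
      fourierInner τ u fun p => (f p.1 : ℂ) * v p := by
  simp only [fourierInner, partialFourier_coord_mul, map_mul, Complex.conj_ofReal,
    mul_left_comm, mul_assoc]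

lemma fourierInner_T_left (hu : IsTest u) :
    fourierInner τ (T u) v = ((2 * Real.pi * τ : ℝ) : ℂ) * Complex.I * fourierInner τ u v := by
  simp only [fourierInner, partialFourier_T hu, mul_assoc, integral_const_mul]

lemma fourierInner_T_right (hv : IsTest v) :
    fourierInner τ u (T v) = -(((2 * Real.pi * τ : ℝ) : ℂ) * Complex.I * fourierInner τ u v) := by
  rw [← conj_fourierInner, fourierInner_T_left hv, map_mul, map_mul, conj_fourierInner,
    Complex.conj_ofReal, Complex.conj_I, mul_neg, neg_mul]

lemma fourierInner_fderiv (hu : IsTest u) (hv : IsTest v) (e : ℝ × ℝ) :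
    fourierInner τ (fun p => fderiv ℝ u p (e.1, e.2, 0)) v =
      -fourierInner τ u fun p => fderiv ℝ v p (e.1, e.2, 0) := by
  have hparts := integral_mul_fderiv_eq_neg_fderiv_mul_of_integrable
    (μ := (volume : Measure (ℝ × ℝ))) (f := partialFourier τ u)
    (g := fun q => (starRingEnd ℂ) (partialFourier τ v q)) (v := e)
    (by simpa only [fderiv_partialFourier hu] using
      integrable_partialFourier_mul_conj (hu.fderiv_apply _) hv)
    (by simpa only [fderiv_conj, fderiv_partialFourier hv] using
      integrable_partialFourier_mul_conj hu (hv.fderiv_apply _))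
    (integrable_partialFourier_mul_conj hu hv) (fun q _ => differentiable_partialFourier hu q)
    fun q _ => Complex.conjCLE.differentiable.comp (differentiable_partialFourier hv) q
  simp only [fderiv_conj, fderiv_partialFourier hu, fderiv_partialFourier hv] at hparts
  exact neg_eq_iff_eq_neg.1 hparts.symm

lemma fourierInner_X_left (hu : IsTest u) (hv : IsTest v) :
    fourierInner τ (X u) v = -fourierInner τ u (X v) :=
  fourierInner_fderiv hu hv (1, 0)

lemma fourierInner_Y_left (hu : IsTest u) (hv : IsTest v) :
    fourierInner τ (Y k u) v = -fourierInner τ u (Y k v) := by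
  have hpow : ContDiff ℝ ∞ fun x : ℝ => x ^ k := contDiff_id.pow k
  have hY (w : R3 → ℂ) :
      Y k w = fun p => fderiv ℝ w p (0, 1, 0) + ((p.1 ^ k : ℝ) : ℂ) * T w p :=
    funext Y_eq_fderiv_add_T
  rw [hY u, hY v, fourierInner_add_left (hu.fderiv_apply _) (hu.T.coord_mul hpow) hv,
    fourierInner_add_right hu (hv.fderiv_apply _) (hv.T.coord_mul hpow),
    fourierInner_fderiv hu hv (0, 1), fourierInner_coord_mul (fun x => x ^ k),
    fourierInner_T_left hu, ← fourierInner_coord_mul (fun x => x ^ k) (v := T v),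
    fourierInner_T_right hv, fourierInner_coord_mul (fun x => x ^ k)]
  ring

lemma fourierNormSq_T (hu : IsTest u) :
    fourierNormSq τ (T u) = (2 * Real.pi * τ) ^ 2 * fourierNormSq τ u := by
  have hnorm (q : ℝ × ℝ) : ‖partialFourier τ (T u) q‖ ^ 2 =
      (2 * Real.pi * τ) ^ 2 * ‖partialFourier τ u q‖ ^ 2 := by
    rw [partialFourier_T hu, norm_mul, norm_mul, Complex.norm_I, mul_one, Complex.norm_real,
      Real.norm_eq_abs, mul_pow, sq_abs]
  simp only [fourierNormSq, hnorm, integral_const_mul]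

lemma fourierNormSq_coord_mul_le {f : ℝ → ℝ} {c δ : ℝ} (hu : IsTest u)
    (hsupp : ∀ p : R3, u p ≠ 0 → |p.1| ≤ δ) (hf : ∀ x, |x| ≤ δ → |f x| ≤ c) :
    fourierNormSq τ (fun p => (f p.1 : ℂ) * u p) ≤ c ^ 2 * fourierNormSq τ u := by
  rw [fourierNormSq, fourierNormSq, ← integral_const_mul]
  refine integral_mono_of_nonneg (.of_forall fun q => by positivity)
    ((integrable_norm_sq_partialFourier hu).const_mul _) (.of_forall fun q => ?_)
  simp only [partialFourier_coord_mul, norm_mul, Complex.norm_real, Real.norm_eq_abs, mul_pow]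
  by_cases hq : |q.1| ≤ δ
  · gcongr
    exact hf _ hq
  · have hslice (t : ℝ) : u (q.1, q.2, t) = 0 := by
      by_contra hne
      exact hq (hsupp _ hne)
    simp [partialFourier_eq, hslice]

lemma ofReal_integral_norm_sq_eq_lintegral_fourierNormSq (hu : IsTest u) :
    ENNReal.ofReal (∫ p, ‖u p‖ ^ 2) = ∫⁻ τ, ENNReal.ofReal (fourierNormSq τ u) := by
  rw [ofReal_integral_eq_lintegral_ofReal ((memLp_two_iff_integrable_sq_norm hu.memLp.1).1 hu.memLp)
    (.of_forall fun _ => by positivity), ← lintegral_lintegral_norm_sq_partialFourier hu]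
  refine lintegral_congr fun τ => ?_
  rw [fourierNormSq, ofReal_integral_eq_lintegral_ofReal (integrable_norm_sq_partialFourier hu)
    (.of_forall fun _ => by positivity)]

lemma measurable_fourierNormSq (hu : IsTest u) : Measurable fun τ => fourierNormSq τ u :=
  ((continuous_partialFourier hu).norm.pow 2).stronglyMeasurable.integral_prod_right.measurable

end FourierInner

/-- The coefficient `1 - x⁴`. It takes the exceptional value `1` at the origin, to which it is flat
to third order, and is smaller than `1` elsewhere. -/
def quartic (x : ℝ) : ℝ := 1 - x ^ 4

section Quartic

variable {u : R3 → ℂ} {τ : ℝ}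

lemma contDiff_quartic : ContDiff ℝ ∞ quartic := contDiff_const.sub (contDiff_id.pow 4)

lemma iteratedDeriv_quartic : iteratedDeriv 1 quartic 0 = 0 ∧ iteratedDeriv 2 quartic 0 = 0 := by
  have hderiv : deriv quartic = fun x => -(4 * x ^ 3) := by
    funext x
    exact ((hasDerivAt_pow 4 x).const_sub 1).deriv.trans (by norm_num)
  have hderiv2 : HasDerivAt (fun x : ℝ => -(4 * x ^ 3)) _ 0 :=
    ((hasDerivAt_pow 3 0).const_mul 4).neg
  refine ⟨?_, ?_⟩
  · rw [iteratedDeriv_one, hderiv]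
    norm_num
  · rw [iteratedDeriv_succ, iteratedDeriv_one, hderiv, hderiv2.deriv]
    norm_num

lemma abs_mul_fourierNormSq_le (hu : IsTest u) :
    |2 * Real.pi * τ| * fourierNormSq τ u ≤ fourierNormSq τ (X u) + fourierNormSq τ (Y 1 u) := by
  have hT : T u = fun p => X (Y 1 u) p + -1 * Y 1 (X u) p := by
    funext p
    have h := XY_eq_T (k := 1) hu.contDiff p
    simp only [Nat.cast_one, Nat.sub_self, pow_zero, mul_one, Complex.ofReal_one, one_mul] at h
    rw [← h, XY]
    ring
  have hYX : IsTest fun p => -1 * Y 1 (X u) p := hu.X.Y.const_mul _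
  have hcomm : ((2 * Real.pi * τ : ℝ) : ℂ) * Complex.I * fourierNormSq τ u =
      fourierInner τ (X u) (Y 1 u) - (starRingEnd ℂ) (fourierInner τ (X u) (Y 1 u)) := by
    rw [← fourierInner_self, ← fourierInner_T_left hu, hT, fourierInner_add_left hu.Y.X hYX hu,
      fourierInner_const_mul_left, fourierInner_X_left hu.Y hu, fourierInner_Y_left hu.X hu,
      conj_fourierInner]
    ring
  have hnorm : |2 * Real.pi * τ| * fourierNormSq τ u ≤ 2 * ‖fourierInner τ (X u) (Y 1 u)‖ := by
    have h := norm_sub_le (fourierInner τ (X u) (Y 1 u))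
      ((starRingEnd ℂ) (fourierInner τ (X u) (Y 1 u)))
    rwa [← hcomm, RCLike.norm_conj, ← two_mul, norm_mul, norm_mul, Complex.norm_I, mul_one,
      Complex.norm_real, Complex.norm_real, Real.norm_eq_abs,
      Real.norm_of_nonneg fourierNormSq_nonneg] at h
  refine hnorm.trans ?_
  have hcs := norm_fourierInner_sq_le (τ := τ) hu.X (hu.Y (k := 1))
  have hX : 0 ≤ fourierNormSq τ (X u) := fourierNormSq_nonneg
  have hY : 0 ≤ fourierNormSq τ (Y 1 u) := fourierNormSq_nonneg
  refine abs_le_of_sq_le_sq' (?_ : _ ≤ _) (add_nonneg hX hY) |>.2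
  nlinarith [sq_nonneg (fourierNormSq τ (X u) - fourierNormSq τ (Y 1 u))]

lemma X_coord_mul (hu : Differentiable ℝ u) :
    X (fun p => (p.1 : ℂ) * u p) = fun p => u p + (p.1 : ℂ) * X u p := by
  have hx : Differentiable ℝ fun p : R3 => (p.1 : ℂ) :=
    (contDiff_coord contDiff_id).differentiable (by simp)
  have hXx (p : R3) : X (fun p : R3 => (p.1 : ℂ)) p = 1 :=
    fderiv_eq_of_hasDerivAt (hx p) (by simpa using hasDerivAt_ofReal_add_mul p.1 1)
  rw [X_mul hx hu]
  funext p
  rw [hXx]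
  ring

lemma fourierNormSq_sq_le_mul_X (hu : IsTest u) :
    fourierNormSq τ u ^ 2 ≤
      4 * fourierNormSq τ (fun p => (p.1 : ℂ) * u p) * fourierNormSq τ (X u) := by
  have hid : ContDiff ℝ ∞ fun x : ℝ => x := contDiff_id
  have hxu := hu.coord_mul hid
  set z := fourierInner τ (fun p => (p.1 : ℂ) * u p) (X u) with hz
  have hcomm : (fourierNormSq τ u : ℂ) = -(z + (starRingEnd ℂ) z) := by
    have h := fourierInner_X_left (τ := τ) hxu hu
    rw [X_coord_mul hu.differentiable, fourierInner_add_left hu (hu.X.coord_mul hid) hu,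
      fourierInner_self, fourierInner_coord_mul fun x => x, ← conj_fourierInner, ← hz] at h
    linear_combination h
  have hnorm : fourierNormSq τ u ≤ 2 * ‖z‖ := by
    have h := norm_add_le z ((starRingEnd ℂ) z)
    rwa [← norm_neg, ← hcomm, RCLike.norm_conj, ← two_mul, Complex.norm_real,
      Real.norm_of_nonneg fourierNormSq_nonneg] at h
  calc fourierNormSq τ u ^ 2 ≤ (2 * ‖z‖) ^ 2 := pow_le_pow_left₀ fourierNormSq_nonneg hnorm 2
    _ = 4 * ‖z‖ ^ 2 := by ring
    _ ≤ 4 * (fourierNormSq τ (fun p => (p.1 : ℂ) * u p) * fourierNormSq τ (X u)) := by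
        gcongr
        exact norm_fourierInner_sq_le hxu hu.X
    _ = _ := by ring

lemma fourierNormSq_coord_mul_sq_le (hu : IsTest u) :
    fourierNormSq τ (fun p => (p.1 : ℂ) * u p) ^ 2 ≤
      fourierNormSq τ u * fourierNormSq τ (fun p => ((p.1 ^ 2 : ℝ) : ℂ) * u p) := by
  have hsq : ContDiff ℝ ∞ fun x : ℝ => x ^ 2 := contDiff_id.pow 2
  have hinner : fourierInner τ u (fun p => ((p.1 ^ 2 : ℝ) : ℂ) * u p) =
      fourierNormSq τ fun p => (p.1 : ℂ) * u p := by
    rw [← fourierInner_self, fourierInner_coord_mul fun x => x]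
    congr 1
    funext p
    push_cast
    ring
  have h := norm_fourierInner_sq_le (τ := τ) hu (hu.coord_mul hsq)
  rwa [hinner, Complex.norm_real, Real.norm_eq_abs, sq_abs] at h

lemma fourierInner_quartic_mul_T (hu : IsTest u) :
    fourierInner τ (fun p => (quartic p.1 : ℂ) * T u p) u =
      ((2 * Real.pi * τ : ℝ) : ℂ) * Complex.I * ((fourierNormSq τ u -
        fourierNormSq τ (fun p => ((p.1 ^ 2 : ℝ) : ℂ) * u p) : ℝ) : ℂ) := by
  have hsq : ContDiff ℝ ∞ fun x : ℝ => x ^ 2 := contDiff_id.pow 2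
  have hquartic : (fun p => (quartic p.1 : ℂ) * u p) = fun p => u p +
      -1 * (((p.1 ^ 2 : ℝ) : ℂ) * (((p.1 ^ 2 : ℝ) : ℂ) * u p)) := by
    funext p
    rw [quartic]
    push_cast
    ring
  rw [fourierInner_coord_mul, fourierInner_T_left hu, ← fourierInner_coord_mul, hquartic,
    fourierInner_add_left hu (((hu.coord_mul hsq).coord_mul hsq).const_mul _) hu,
    fourierInner_const_mul_left, fourierInner_coord_mul fun x => x ^ 2, fourierInner_self,
    fourierInner_self]
  push_cast
  ring

lemma fourierInner_Lt_quartic (hu : IsTest u) :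
    fourierInner τ (Lt 1 quartic u) u = ((fourierNormSq τ (X u) + fourierNormSq τ (Y 1 u) +
      2 * Real.pi * τ * (fourierNormSq τ u -
        fourierNormSq τ (fun p => ((p.1 ^ 2 : ℝ) : ℂ) * u p)) : ℝ) : ℂ) := by
  have hLt : Lt 1 quartic u = fun p => -1 * X (X u) p + (-1 * Y 1 (Y 1 u) p +
      -Complex.I * ((quartic p.1 : ℂ) * T u p)) := by
    funext p
    simp only [Lt, L, XY_eq_T hu.contDiff]
    push_cast
    ring
  have hXX : IsTest fun p => -1 * X (X u) p := hu.X.X.const_mul _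
  have hYY : IsTest fun p => -1 * Y 1 (Y 1 u) p := hu.Y.Y.const_mul _
  have hqT : IsTest fun p => -Complex.I * ((quartic p.1 : ℂ) * T u p) :=
    (hu.T.coord_mul contDiff_quartic).const_mul _
  rw [hLt, fourierInner_add_left hXX (hYY.add hqT) hu, fourierInner_add_left hYY hqT hu,
    fourierInner_const_mul_left, fourierInner_const_mul_left, fourierInner_const_mul_left,
    fourierInner_X_left hu.X hu, fourierInner_Y_left hu.Y hu, fourierInner_quartic_mul_T hu,
    fourierInner_self, fourierInner_self]
  generalize fourierNormSq τ (fun p => ((p.1 ^ 2 : ℝ) : ℂ) * u p) = n₂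
  push_cast
  linear_combination (-(2 * Real.pi * τ : ℂ) * (fourierNormSq τ u - n₂)) * Complex.I_sq

/-- Put `n = ‖û‖²`, `n₁ = ‖xû‖²`, `n₂ = ‖x²û‖²`, with `q` the energy. Only `θ < -1` is delicate:
there `h₁`, `h₂` give `n³ ≤ 16 n₂ nX²`, while `-θ n₂ ≤ q` and `nX ≤ q - θ n`. -/
lemma le_mul_energy {n n₁ n₂ nX nY θ q : ℝ} (hn : 0 ≤ n) (hn₂ : 0 ≤ n₂)
    (hnX : 0 ≤ nX) (hnY : 0 ≤ nY) (hq : q = nX + nY + θ * (n - n₂)) (hcomm : |θ| * n ≤ nX + nY)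
    (h₁ : n ^ 2 ≤ 4 * n₁ * nX) (h₂ : n₁ ^ 2 ≤ n * n₂) (hn₁ : n₁ ≤ n / 16) (hn₂n : n₂ ≤ n) :
    n ≤ 32 * (1 + |θ|) * q := by
  have hpoincare : n ≤ nX / 4 := by
    rcases hn.eq_or_lt with rfl | hpos
    · positivity
    · exact le_of_mul_le_mul_left (by nlinarith : n * n ≤ n * (nX / 4)) hpos
  have of_le (h : n ≤ q) : n ≤ 32 * (1 + |θ|) * q := by
    nlinarith [mul_nonneg (abs_nonneg θ) (hn.trans h)]
  rcases le_or_gt (-1) θ with hθ | hθ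
  · exact of_le (by nlinarith [mul_nonneg (by linarith : 0 ≤ θ + 1) (sub_nonneg.2 hn₂n)])
  obtain ⟨t, rfl⟩ : ∃ t, θ = -t := ⟨-θ, (neg_neg θ).symm⟩
  have ht : 1 < t := by linarith
  rw [abs_neg, abs_of_pos (by linarith)] at hcomm of_le ⊢
  have hq₂ : t * n₂ ≤ q := by linarith
  have hqX : nX ≤ q + t * n := by nlinarith
  rcases le_or_gt n q with hnq | hqn
  · exact of_le hnq
  have hq0 : 0 ≤ q := (by positivity : 0 ≤ t * n₂).trans hq₂
  have hn0 : 0 < n := hq0.trans_lt hqn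
  have hquartic : n ^ 3 * (t * n) ≤ n ^ 3 * (16 * (1 + t) ^ 2 * q) :=
    calc n ^ 3 * (t * n) = t * (n ^ 2) ^ 2 := by ring
      _ ≤ t * (4 * n₁ * nX) ^ 2 := by gcongr
      _ = 16 * t * nX ^ 2 * n₁ ^ 2 := by ring
      _ ≤ 16 * t * nX ^ 2 * (n * n₂) := by gcongr
      _ = 16 * n * nX ^ 2 * (t * n₂) := by ring
      _ ≤ 16 * n * ((1 + t) * n) ^ 2 * q := by
        gcongr
        linarith
      _ = _ := by ring
  have htn : t * n ≤ t * (32 * (1 + t) * q) :=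
    (le_of_mul_le_mul_left hquartic (by positivity)).trans (by
      nlinarith [mul_nonneg hq0 (by linarith : 0 ≤ t - 1), mul_nonneg hq0 (by linarith : 0 ≤ t)])
  exact le_of_mul_le_mul_left htn (by linarith)

lemma fourierNormSq_le_mul_norm_fourierInner_Lt (hu : IsTest u)
    (hsupp : ∀ p : R3, u p ≠ 0 → |p.1| ≤ 1 / 4) :
    fourierNormSq τ u ≤
      32 * (1 + |2 * Real.pi * τ|) * ‖fourierInner τ (Lt 1 quartic u) u‖ := by
  have hxu : fourierNormSq τ (fun p => (p.1 : ℂ) * u p) ≤ fourierNormSq τ u / 16 :=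
    (fourierNormSq_coord_mul_le hu hsupp fun _ hx => hx).trans_eq (by ring)
  have hx2u : fourierNormSq τ (fun p => ((p.1 ^ 2 : ℝ) : ℂ) * u p) ≤ fourierNormSq τ u := by
    have hle (x : ℝ) (hx : |x| ≤ 1 / 4) : |x ^ 2| ≤ 1 := by
      rw [abs_pow]
      exact pow_le_one₀ (abs_nonneg x) (by linarith)
    exact (fourierNormSq_coord_mul_le hu hsupp hle).trans_eq (by ring)
  refine (le_mul_energy fourierNormSq_nonneg fourierNormSq_nonneg fourierNormSq_nonneg
    fourierNormSq_nonneg rfl (abs_mul_fourierNormSq_le hu) (fourierNormSq_sq_le_mul_X hu)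
    (fourierNormSq_coord_mul_sq_le hu) hxu hx2u).trans ?_
  rw [fourierInner_Lt_quartic hu, Complex.norm_real]
  gcongr
  exact Real.le_norm_self _

theorem fourierNormSq_le (hu : IsTest u) (hsupp : ∀ p : R3, u p ≠ 0 → |p.1| ≤ 1 / 4) :
    fourierNormSq τ u ≤ 2048 * (fourierNormSq τ (Lt 1 quartic u) +
      fourierNormSq τ (T (Lt 1 quartic u))) := by
  have hLtu : IsTest (Lt 1 quartic u) := hu.Lt contDiff_quartic
  rw [fourierNormSq_T hLtu]
  set θ := 2 * Real.pi * τ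
  set n := fourierNormSq τ u
  set nL := fourierNormSq τ (Lt 1 quartic u)
  have hn0 : 0 ≤ n := fourierNormSq_nonneg
  have hnL0 : 0 ≤ nL := fourierNormSq_nonneg
  have hsq : n * n ≤ n * (2048 * (nL + θ ^ 2 * nL)) :=
    calc n * n = n ^ 2 := (sq n).symm
      _ ≤ (32 * (1 + |θ|) * ‖fourierInner τ (Lt 1 quartic u) u‖) ^ 2 := by
        gcongr
        exact fourierNormSq_le_mul_norm_fourierInner_Lt hu hsupp
      _ = 1024 * (1 + |θ|) ^ 2 * ‖fourierInner τ (Lt 1 quartic u) u‖ ^ 2 := by ring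
      _ ≤ 1024 * (2 * (1 + θ ^ 2)) * (nL * n) := by
        gcongr
        · nlinarith [sq_nonneg (1 - |θ|), sq_abs θ]
        · exact norm_fourierInner_sq_le hLtu hu
      _ = _ := by ring
  rcases hn0.eq_or_lt with hzero | hpos
  · rw [← hzero]
    positivity
  · exact le_of_mul_le_mul_left hsq hpos

/-- The factor `1 + θ²` of `fourierNormSq_le` costs one derivative `∂_t` on the right-hand side. -/
theorem integral_norm_sq_le_of_support (hu : IsTest u)
    (hsupp : ∀ p : R3, u p ≠ 0 → |p.1| ≤ 1 / 4) :
    ∫ p, ‖u p‖ ^ 2 ≤ 2048 * ((∫ p, ‖Lt 1 quartic u p‖ ^ 2) +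
      ∫ p, ‖T (Lt 1 quartic u) p‖ ^ 2) := by
  have hLtu : IsTest (Lt 1 quartic u) := hu.Lt contDiff_quartic
  have integral_nonneg (v : R3 → ℂ) : 0 ≤ ∫ p, ‖v p‖ ^ 2 :=
    integral_nonneg fun _ => by positivity
  rw [← ENNReal.ofReal_le_ofReal_iff
      (mul_nonneg (by norm_num) (add_nonneg (integral_nonneg _) (integral_nonneg _))),
    ENNReal.ofReal_mul (by norm_num),
    ENNReal.ofReal_add (integral_nonneg _) (integral_nonneg _),
    ofReal_integral_norm_sq_eq_lintegral_fourierNormSq hu,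
    ofReal_integral_norm_sq_eq_lintegral_fourierNormSq hLtu,
    ofReal_integral_norm_sq_eq_lintegral_fourierNormSq hLtu.T,
    ← lintegral_add_left (measurable_fourierNormSq hLtu).ennreal_ofReal,
    ← lintegral_const_mul' _ _ ENNReal.ofReal_ne_top]
  refine lintegral_mono fun τ => ?_
  rw [← ENNReal.ofReal_add fourierNormSq_nonneg fourierNormSq_nonneg,
    ← ENNReal.ofReal_mul (by norm_num)]
  exact ENNReal.ofReal_le_ofReal (fourierNormSq_le hu hsupp)

end Quartic

section Solvability

variable {V : Opens R3} {k : ℕ} {a : ℝ → ℝ}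

/-- The inclusion of the test functions on `V` into `L²(ℝ³)`. -/
def testToL2 (V : Opens R3) : 𝓓(V, ℂ) →ₗ[ℂ] Lp ℂ 2 (volume : Measure R3) where
  toFun ψ := (IsTest.of_testFunction ψ).memLp.toLp ψ
  map_add' ψ φ :=
    MemLp.toLp_add (IsTest.of_testFunction ψ).memLp (IsTest.of_testFunction φ).memLp
  map_smul' c ψ := MemLp.toLp_const_smul c (IsTest.of_testFunction ψ).memLp

lemma norm_testToL2_sq (ψ : 𝓓(V, ℂ)) : ‖testToL2 V ψ‖ ^ 2 = ∫ p, ‖ψ p‖ ^ 2 :=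
  norm_toLp_sq (IsTest.of_testFunction ψ).memLp

lemma exists_continuousLinearMap_eq_integral_mul {g : R3 → ℂ} (hg : MemLp g 2 volume) :
    ∃ u : 𝓓(V, ℂ) →L[ℂ] ℂ, ∀ ψ : 𝓓(V, ℂ), u ψ = ∫ p, ψ p * g p :=
  ⟨TestFunction.integralAgainstBilinCLM (ContinuousLinearMap.mul ℂ ℂ) volume g, fun _ =>
    TestFunction.integralAgainstBilinCLM_eq_integral
      ((hg.locallyIntegrable (by norm_num)).locallyIntegrableOn _)⟩

lemma exists_continuousLinearMap_eq_comp_testToL2 (Λ : Lp ℂ 2 (volume : Measure R3) →L[ℂ] ℂ) :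
    ∃ u : 𝓓(V, ℂ) →L[ℂ] ℂ, ∀ ψ : 𝓓(V, ℂ), u ψ = Λ (testToL2 V ψ) := by
  obtain ⟨g, hg, hΛ⟩ := exists_memLp_forall_eq_integral_mul Λ
  obtain ⟨u, hu⟩ := exists_continuousLinearMap_eq_integral_mul (V := V) hg
  exact ⟨u, fun ψ => (hu ψ).trans (hΛ ψ (IsTest.of_testFunction ψ).memLp).symm⟩

/-- The transposed operator `Lt` as a linear map of the space of test functions. -/
def LtLinearMap (k : ℕ) (ha : ContDiff ℝ ∞ a) (V : Opens R3) : 𝓓(V, ℂ) →ₗ[ℂ] 𝓓(V, ℂ) where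
  toFun := LtTest k a ha
  map_add' ψ φ := by
    have hLt : Lt k a (ψ + φ) = fun p => Lt k a ψ p + Lt k a φ p :=
      L_add ψ.contDiff φ.contDiff
    exact DFunLike.coe_injective hLt
  map_smul' c ψ := by
    have hLt : Lt k a (c • ψ) = fun p => c * Lt k a ψ p := L_const_mul c ψ.contDiff
    exact DFunLike.coe_injective hLt

/-- The operator `T` on test functions, continuous for the topology which defines distributions. -/
def testT (V : Opens R3) : 𝓓(V, ℂ) →L[ℂ] 𝓓(V, ℂ) :=
  TestFunction.lineDerivCLM ℂ ((0, 0, 1) : R3)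

lemma coe_testT (ψ : 𝓓(V, ℂ)) : ⇑(testT V ψ) = T ψ := by
  funext p
  exact (TestFunction.lineDerivCLM_apply_of_le (by simp)).trans
    ((IsTest.of_testFunction ψ).differentiable p).lineDeriv_eq_fderiv

/-- By the estimate, `ψ ↦ ∫ f ψ` is a bounded functional of the pair `(Lt ψ, T (Lt ψ))`; its
extension `Λ` to `L² × L²` is of the form `(v, w) ↦ ∫ (g₁ v + g₂ w)`, and `u = g₁ - T g₂`. -/
theorem locallySolvable_of_estimate (ha : ContDiff ℝ ∞ a) (h0 : (0 : R3) ∈ V) {C : ℝ} (hC0 : 0 ≤ C)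
    (hC : ∀ ψ : 𝓓(V, ℂ), ∫ p, ‖ψ p‖ ^ 2 ≤
      C * ((∫ p, ‖Lt k a ψ p‖ ^ 2) + ∫ p, ‖T (Lt k a ψ) p‖ ^ 2)) :
    LocallySolvable k a ha := by
  refine ⟨V, h0, fun f => ?_⟩
  have hf := (IsTest.of_testFunction f).memLp
  obtain ⟨l, hl⟩ := exists_continuousLinearMap_eq_integral_mul (V := V) hf
  set M := ((testToL2 V).prod (testToL2 V ∘ₗ (testT V).toLinearMap)) ∘ₗ LtLinearMap k ha V with hM
  have hbound (ψ : 𝓓(V, ℂ)) : ‖l ψ‖ ≤ √((∫ p, ‖f p‖ ^ 2) * (2 * C)) * ‖M ψ‖ := by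
    have hLt : ∫ p, ‖Lt k a ψ p‖ ^ 2 ≤ ‖M ψ‖ ^ 2 :=
      (norm_testToL2_sq (LtTest k a ha ψ)).symm.trans_le (by gcongr; exact norm_fst_le (M ψ))
    have hTLt : ∫ p, ‖T (Lt k a ψ) p‖ ^ 2 ≤ ‖M ψ‖ ^ 2 := by
      have h := norm_testToL2_sq (testT V (LtTest k a ha ψ))
      rw [coe_testT] at h
      exact h.symm.trans_le (by gcongr; exact norm_snd_le (M ψ))
    have hsq : ‖l ψ‖ ^ 2 ≤ (∫ p, ‖f p‖ ^ 2) * (2 * C) * ‖M ψ‖ ^ 2 :=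
      calc ‖l ψ‖ ^ 2 ≤ (∫ p, ‖ψ p‖ ^ 2) * ∫ p, ‖f p‖ ^ 2 := by
            rw [hl]
            exact norm_integral_mul_sq_le (IsTest.of_testFunction ψ).memLp hf
        _ ≤ C * (‖M ψ‖ ^ 2 + ‖M ψ‖ ^ 2) * ∫ p, ‖f p‖ ^ 2 := by
            gcongr
            exact (hC ψ).trans (by gcongr)
        _ = _ := by ring
    rw [← Real.sqrt_sq (norm_nonneg (M ψ)), ← Real.sqrt_mul' _ (by positivity)]
    exact Real.le_sqrt_of_sq_le hsq
  obtain ⟨Λ, hΛ⟩ := exists_continuousLinearMap_comp_eq M l.toLinearMap hbound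
  obtain ⟨u₁, hu₁⟩ := exists_continuousLinearMap_eq_comp_testToL2 (V := V)
    (Λ ∘L ContinuousLinearMap.inl ℂ _ _)
  obtain ⟨u₂, hu₂⟩ := exists_continuousLinearMap_eq_comp_testToL2 (V := V)
    (Λ ∘L ContinuousLinearMap.inr ℂ _ _)
  refine ⟨u₁ + u₂ ∘L testT V, fun ψ => ?_⟩
  calc u₁ (LtTest k a ha ψ) + u₂ (testT V (LtTest k a ha ψ)) = Λ (M ψ) := by
        simp [hu₁, hu₂, hM, LtLinearMap, ← map_add]
    _ = l ψ := hΛ ψ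
    _ = ∫ p, f p * ψ p := by simp only [hl, mul_comm]

theorem locallySolvable_quartic : LocallySolvable 1 quartic contDiff_quartic := by
  let V : Opens R3 := ⟨{p | |p.1| < 1 / 4}, isOpen_lt (by fun_prop) continuous_const⟩
  refine locallySolvable_of_estimate (V := V) (C := 2048) contDiff_quartic
    (by simp [V]) (by norm_num) fun ψ =>
      integral_norm_sq_le_of_support (IsTest.of_testFunction ψ) fun p hp => ?_
  have hpV : p ∈ V := ψ.tsupport_subset (subset_tsupport _ hp)
  exact le_of_lt hpV

end Solvability

end DoubleChar

end

theorem mainTheorem10 :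
    (∀ (k : ℕ) (a : ℝ → ℝ), ContDiff ℝ ∞ a →
      ((k = 1 ∧ ∃ m : ℤ, Odd m ∧ a 0 = m) ∨ (1 < k ∧ Odd k ∧ (a 0 = 1 ∨ a 0 = -1))) →
      iteratedDeriv 1 a 0 = 0 → iteratedDeriv 2 a 0 = 0 →
      ¬ DoubleChar.LocallySolvableL2 k a) ∧
    (∃ (k : ℕ) (a : ℝ → ℝ) (ha : ContDiff ℝ ∞ a), 1 ≤ k ∧
      DoubleChar.LocallySolvable k a ha ∧ ¬ DoubleChar.LocallySolvableL2 k a) := by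
  refine ⟨fun k a ha h h1 h2 => DoubleChar.not_locallySolvableL2 ha h h1 h2,
    1, DoubleChar.quartic, DoubleChar.contDiff_quartic, le_rfl,
    DoubleChar.locallySolvable_quartic, ?_⟩
  exact DoubleChar.not_locallySolvableL2 DoubleChar.contDiff_quartic
    (Or.inl ⟨rfl, 1, odd_one, by simp [DoubleChar.quartic]⟩)
    DoubleChar.iteratedDeriv_quartic.1 DoubleChar.iteratedDeriv_quartic.2
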